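/- \textbf{Theorem 3 (isometry between $L(4,1)$ and $PTS^2$).} Let $p_1=\frac12\begin{pmatrix}0&1\\-1&0\end{pmatrix}$, $p_2=\frac12\begin{pmatrix}0&i\\i&0\end{pmatrix}\in su(2)$ and $\mathbf p=\mathrm{span}\{p_1,p_2\}$. On $SU(2)$ consider the distribution $\Delta(g)=g\,\mathbf p$ with the metric $\langle g^{-1}v,g^{-1}w\rangle$, $\langle X,Y\rangle=-2\,\mathrm{Tr}(XY)$, for which $gp_1,gp_2$ are orthonormal. Write $(a,b,c)=e^{-bp_2}e^{ap_1}e^{cp_2}$ for $a\in[0,\pi]$, $b,c\in\mathbb R$. Let $L(4,1)$ be the quotient manifold of $SU(2)$ by the identifications $(a,b,c)\approx(a,b,c+k\pi)$, $k\in\mathbb Z$ (the quotient by right multiplication by the cyclic group of order $4$ generated by $e^{\pi p_2}$), with quotient map $\Pi$, and give it the distribution $\Pi_*\Delta$ with the metric for which $\Pi_*$ is isometric. Let $S^2\subset\mathbb R^3$ be the unit sphere with its standard metric $\mathbf g$, and let $PTS^2$ be its bundle of unoriented directions, i.e. the manifold of pairs $(x,\ell)$ with $x\in S^2$ and $\ell$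 a line through $0$ in $T_xS^2$. The point of $PTS^2$ with coordinates $(a,b,\xi)$ is the direction of $\cos\xi\,e_a+\sin\xi\,e_b$ at $(\sin a\cos b,\sin a\sin b,\cos a)$, where $e_a=(\cos a\cos b,\cos a\sin b,-\sin a)$ and $e_b=(-\sin b,\cos b,0)$. The distribution on $PTS^2$ consists of the vectors tangent at $(x,\ell)$ whose projection to $T_xS^2$ lies in $\ell$. On both manifolds a curve is horizontal if it is Lipschitz on $[0,T]$ and its velocity belongs to the distribution for almost every $t$. For a horizontal curve $\Gamma=(\gamma,\ell)$ in $PTS^2$ put $$\mathcal J[\Gamma]=\int_0^T\sqrt{\mathbf g(\dot\gamma,\dot\gamma)+|\nabla_t v|^2}\;dt ,$$ where $v(t)$ is a unit vector spanning $\ell(t)$ (locally chosen continuously) and $\nabla_t$ is the covariant derivative along $\gamma$; in coordinates the integrand is $\sqrt{\dot a^2+\sin^2\!a\,\dot b^2+(\dot\xi+\cos a\,\dot b)^2}$. Then there is a $C^\infty$ diffeomorphism $f:L(4,1)\to PTS^2$ such that: 1. for all $a\in[0,\pi]$ and $b,c\in\mathbb R$, $f$ maps $[(a,b,c)]$ to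 the point with coordinates $(a,b,-c)$; 2. for all $T>0$, a curve $\lambda:[0,T]\to L(4,1)$ is horizontal if and only if $f\circ\lambda$ is horizontal; 3. the sub-Riemannian length of every horizontal curve $\lambda$ in $L(4,1)$ equals $\mathcal J[f\circ\lambda]$; 4. in particular, if $\gamma:[0,T]\to S^2$ is a $C^2$ curve with $\dot\gamma(t)\ne0$ for all $t$ and geodesic curvature $K_\gamma$, then its lift $\Gamma(t)=(\gamma(t),\mathbb R\dot\gamma(t))$ is horizontal, and the length of $f^{-1}\circ\Gamma$ is $\int_0^T\sqrt{\mathbf g(\dot\gamma,\dot\gamma)+K_\gamma^2\,\mathbf g(\dot\gamma,\dot\gamma)}\;dt$. -/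

import Mathlib

open Set Metric MeasureTheory
open scoped Manifold ContDiff Topology LinearAlgebra.Projectivization RealInnerProductSpace NNReal

noncomputable section

namespace LensPTS

abbrev E2 := EuclideanSpace ℝ (Fin 2)
abbrev E3 := EuclideanSpace ℝ (Fin 3)

/-! ### Smooth structures pushed forward by local homeomorphisms -/

section LocalHomeo
variable {H : Type*} [TopologicalSpace H] {E : Type*} [NormedAddCommGroup E] [NormedSpace ℝ E]
  {I : ModelWithCorners ℝ E H} {M N : Type*} [TopologicalSpace M] [TopologicalSpace N]
  [ChartedSpace H M] [IsManifold I ∞ M]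

/-- The charted space structure pushed forward by a surjective local homeomorphism `f` is a smooth
structure, if any two points of a fibre are exchanged by a smooth map over the identity. -/
theorem isManifold_of_deck {f : M → N} (hf : IsLocalHomeomorph f) (hs : Function.Surjective f)
    (hdeck : ∀ x y, f x = f y → ∃ φ : M → M, φ x = y ∧ ContMDiffAt I I ∞ φ x ∧
      ∀ z, f (φ z) = f z) :
    @IsManifold ℝ _ E _ _ H _ I ∞ N _ (hf.chartedSpace hs) := by
  let := hf.chartedSpace (H := H) hs
  refine isManifold_of_contDiffOn I ∞ N ?_
  rintro _ _ ⟨q, rfl⟩ ⟨q', rfl⟩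
  set a := hs.hasRightInverse.choose q
  set b := hs.hasRightInverse.choose q'
  set la := hf.localInverseAt a
  set lb := hf.localInverseAt b
  have hla : ∀ z, la.symm z = f z := fun z => congrFun (hf.localInverseAt_symm a) z
  have hlb : ∀ z, lb.symm z = f z := fun z => congrFun (hf.localInverseAt_symm b) z
  rintro u ⟨hu, hur⟩
  set x := (chartAt H a).symm (I.symm u) with hx
  have hu' := hu
  simp only [mfld_simps] at hu'
  obtain ⟨⟨hu1, hu2⟩, hu3, hu4⟩ := hu'
  rw [← hx] at hu2 hu3 hu4
  rw [hla] at hu3 hu4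
  obtain ⟨φ, hφx, hφ, hφf⟩ := hdeck x (lb (f x)) (by
    rw [← hlb (lb (f x)), lb.left_inv hu3])
  have hxa : x ∈ (chartAt H a).source := (chartAt H a).map_target hu1
  have hφb : φ x ∈ (chartAt H b).source := by rw [hφx]; exact hu4
  have key : ContDiffWithinAt ℝ ∞ ((chartAt H b).extend I ∘ φ ∘ ((chartAt H a).extend I).symm)
      (range I) u := by
    have h1 : ContMDiffWithinAt 𝓘(ℝ, E) I ∞ ((chartAt H a).extend I).symm (range I) u := by
      have := contMDiffWithinAt_extChartAt_symm_range (I := I) (n := ∞) a (y := u) (by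
        rw [extChartAt_target]; exact ⟨hu1, hur⟩)
      exact this
    have h2 : ContMDiffAt I 𝓘(ℝ, E) ∞ ((chartAt H b).extend I) (φ x) :=
      contMDiffAt_extChartAt' (x := b) hφb
    have h3 := (h2.comp x hφ).comp_contMDiffWithinAt_of_eq h1 (x := u) rfl
    exact contMDiffWithinAt_iff_contDiffWithinAt.1 h3
  have hopen : ∀ᶠ v in 𝓝[range I] u, φ ((chartAt H a).symm (I.symm v)) ∈ lb.target := by
    have hc : ContinuousWithinAt (fun v => φ ((chartAt H a).symm (I.symm v))) (range I) u := by
      refine ContinuousAt.continuousWithinAt ?_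
      refine ContinuousAt.comp (f := fun v => (chartAt H a).symm (I.symm v)) hφ.continuousAt ?_
      exact ((chartAt H a).continuousAt_symm hu1).comp I.continuous_symm.continuousAt
    refine hc (lb.open_target.mem_nhds ?_)
    change φ x ∈ _
    rw [hφx]
    exact lb.map_source hu3
  have heq : (I ∘ (((la.trans (chartAt H a)).symm).trans (lb.trans (chartAt H b))) ∘ I.symm)
      =ᶠ[𝓝[range I] u] ((chartAt H b).extend I ∘ φ ∘ ((chartAt H a).extend I).symm) := by
    filter_upwards [hopen] with v hv
    simp only [mfld_simps]
    rw [hla, ← hφf, ← hlb, lb.right_inv hv]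
  have := key.congr_of_eventuallyEq_of_mem heq hur
  exact this.mono inter_subset_right

theorem extChartAt_homeomorph (f : M ≃ₜ N) (y : N) :
    letI := f.chartedSpace (H := H)
    (extChartAt I (f.symm y)) ∘ f.symm =ᶠ[𝓝 y] extChartAt I y := by
  let := f.chartedSpace (H := H)
  set b := f.surjective.hasRightInverse.choose y
  have hb : f b = y := f.surjective.hasRightInverse.choose_spec y
  have hb' : b = f.symm y := by rw [← hb, f.symm_apply_apply]
  set lb := f.isLocalHomeomorph.localInverseAt b
  have hy : y ∈ lb.source := by
    have := f.isLocalHomeomorph.apply_self_mem_localInverseAt_source (x := b)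
    rwa [hb] at this
  filter_upwards [lb.open_source.mem_nhds hy] with z hz
  have hz' : lb z = f.symm z := by
    apply f.injective
    rw [f.isLocalHomeomorph.apply_localInverseAt_of_mem hz, f.apply_symm_apply]
  change extChartAt I (f.symm y) (f.symm z) = I (chartAt H b (lb z))
  rw [hz', ← hb']
  rfl

/-- A homeomorphism is smooth for the transported smooth structure, and so is its inverse. -/
theorem contMDiff_homeomorph_symm (f : M ≃ₜ N) :
    letI := f.chartedSpace (H := H)
    ContMDiff I I ∞ f.symm := by
  let := f.chartedSpace (H := H)
  have : IsManifold I ∞ N := isManifold_of_deck f.isLocalHomeomorph f.surjective fun x y h =>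
    ⟨id, f.injective h, contMDiff_id.contMDiffAt, fun _ => rfl⟩
  intro y
  rw [contMDiffAt_iff_target]
  exact ⟨f.symm.continuous.continuousAt,
    contMDiffAt_extChartAt.congr_of_eventuallyEq (extChartAt_homeomorph f y)⟩

theorem contMDiff_homeomorph (f : M ≃ₜ N) :
    letI := f.chartedSpace (H := H)
    ContMDiff I I ∞ f := by
  let := f.chartedSpace (H := H)
  have : IsManifold I ∞ N := isManifold_of_deck f.isLocalHomeomorph f.surjective fun x y h =>
    ⟨id, f.injective h, contMDiff_id.contMDiffAt, fun _ => rfl⟩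
  intro x
  rw [contMDiffAt_iff_target]
  refine ⟨f.continuous.continuousAt, ?_⟩
  have h := f.continuous.continuousAt.eventually (extChartAt_homeomorph (I := I) f (f x))
  have h' : ContMDiffAt I 𝓘(ℝ, E) ∞ (extChartAt I x) x := contMDiffAt_extChartAt
  refine h'.congr_of_eventuallyEq ?_
  filter_upwards [h] with z hz
  simpa using hz.symm

end LocalHomeo

/-! ### The group `SU(2)` -/

abbrev Mat2 := Matrix (Fin 2) (Fin 2) ℂ
abbrev SU2 := Matrix.specialUnitaryGroup (Fin 2) ℂ

theorem SU2.star_eq (g : SU2) : star (g : Mat2) = !![g.1 1 1, -g.1 0 1; -g.1 1 0, g.1 0 0] := by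
  have h1 : (g : Mat2) * star (g : Mat2) = 1 := g.2.1.2
  have h2 : (g : Mat2).det = 1 := g.2.2
  rw [← Matrix.adjugate_fin_two, ← mul_one (g : Mat2).adjugate, ← h1, ← mul_assoc,
    Matrix.adjugate_mul, h2, one_smul, one_mul]

theorem SU2.apply_one_one (g : SU2) : g.1 1 1 = star (g.1 0 0) := by
  have := congrFun (congrFun (SU2.star_eq g) 0) 0
  simpa [Matrix.star_apply] using this.symm

theorem SU2.apply_one_zero (g : SU2) : g.1 1 0 = - star (g.1 0 1) := by
  have := congrFun (congrFun (SU2.star_eq g) 1) 0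
  rw [eq_neg_iff_add_eq_zero]
  simp [Matrix.star_apply] at this
  simp [this]

/-- The matrix `(α, β; -β̄, ᾱ)` with `α = x₀ + i x₁`, `β = x₂ + i x₃`. -/
def quatMatrix (x : EuclideanSpace ℝ (Fin 4)) : Mat2 :=
  !![⟨x 0, x 1⟩, ⟨x 2, x 3⟩; ⟨-x 2, x 3⟩, ⟨x 0, -x 1⟩]

theorem sum_sq_sphere (x : sphere (0 : EuclideanSpace ℝ (Fin 4)) 1) :
    x.1 0 ^ 2 + x.1 1 ^ 2 + x.1 2 ^ 2 + x.1 3 ^ 2 = 1 := by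
  have h := x.2
  rw [mem_sphere_zero_iff_norm, EuclideanSpace.norm_eq, Real.sqrt_eq_one] at h
  simpa [Fin.sum_univ_four] using h

theorem quatMatrix_mem (x : sphere (0 : EuclideanSpace ℝ (Fin 4)) 1) :
    quatMatrix x ∈ SU2 := by
  have h := sum_sq_sphere x
  rw [Matrix.mem_specialUnitaryGroup_iff, Matrix.mem_unitaryGroup_iff]
  constructor
  · ext i j
    fin_cases i <;> fin_cases j <;> apply Complex.ext <;>
      simp [quatMatrix, Matrix.mul_apply, Fin.sum_univ_two] <;> nlinarith
  · rw [quatMatrix, Matrix.det_fin_two_of]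
    apply Complex.ext <;> simp <;> nlinarith

/-- `SU(2)` is the unit sphere of `ℂ² = ℝ⁴`; this gives its smooth structure. -/
def sphereHomeoSU2 : sphere (0 : EuclideanSpace ℝ (Fin 4)) 1 ≃ₜ SU2 where
  toFun x := ⟨quatMatrix x, quatMatrix_mem x⟩
  invFun g := ⟨WithLp.toLp 2 ![(g.1 0 0).re, (g.1 0 0).im, (g.1 0 1).re, (g.1 0 1).im], by
    have h : (g : Mat2).det = 1 := g.2.2
    rw [Matrix.det_fin_two, SU2.apply_one_one, SU2.apply_one_zero] at h
    have h' := congrArg Complex.re h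
    simp at h'
    rw [mem_sphere_zero_iff_norm, EuclideanSpace.norm_eq, Real.sqrt_eq_one]
    simp [Fin.sum_univ_four]
    nlinarith⟩
  left_inv x := by
    apply Subtype.ext
    ext i
    fin_cases i <;> simp [quatMatrix]
  right_inv g := by
    apply Subtype.ext
    ext i j
    fin_cases i <;> fin_cases j <;>
      simp [quatMatrix, SU2.apply_one_one, SU2.apply_one_zero] <;> apply Complex.ext <;> simp
  continuous_toFun := by
    refine Continuous.subtype_mk (continuous_matrix fun i j => ?_) _
    have : ∀ (k l : Fin 4) (a b : ℝ), Continuous fun x : sphere (0 : EuclideanSpace ℝ (Fin 4)) 1 =>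
        (⟨a * x.1 k, b * x.1 l⟩ : ℂ) := fun k l a b => by
      refine Complex.equivRealProdCLM.symm.continuous.comp (f := fun x : sphere (0 : EuclideanSpace ℝ (Fin 4)) 1 => (a * x.1 k, b * x.1 l)) ?_
      fun_prop
    fin_cases i <;> fin_cases j
    · simpa [quatMatrix] using this 0 1 1 1
    · simpa [quatMatrix] using this 2 3 1 1
    · simpa [quatMatrix] using this 2 3 (-1) 1
    · simpa [quatMatrix] using this 0 1 1 (-1)
  continuous_invFun := by
    refine Continuous.subtype_mk ?_ _
    refine (PiLp.continuous_toLp 2 _).comp (continuous_pi fun i => ?_)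
    have : ∀ i j, Continuous fun g : SU2 => g.1 i j := fun i j =>
      continuous_subtype_val.matrix_elem i j
    fin_cases i
    · exact Complex.continuous_re.comp (this 0 0)
    · exact Complex.continuous_im.comp (this 0 0)
    · exact Complex.continuous_re.comp (this 0 1)
    · exact Complex.continuous_im.comp (this 0 1)

instance : ChartedSpace E3 SU2 := sphereHomeoSU2.chartedSpace

instance : IsManifold (𝓡 3) ∞ SU2 :=
  isManifold_of_deck sphereHomeoSU2.isLocalHomeomorph sphereHomeoSU2.surjective fun _ _ h =>
    ⟨id, sphereHomeoSU2.injective h, contMDiff_id.contMDiffAt, fun _ => rfl⟩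

instance : IsTopologicalGroup SU2 where
  continuous_inv := by
    refine Continuous.subtype_mk ?_ _
    exact continuous_subtype_val.matrix_conjTranspose


/-- The Lie algebra `su(2)`: antihermitian traceless matrices. -/
def su2 : Submodule ℝ Mat2 where
  carrier := {X | star X = -X ∧ X.trace = 0}
  add_mem' := by
    rintro X Y ⟨h1, h2⟩ ⟨h3, h4⟩
    exact ⟨by rw [star_add, h1, h3, neg_add], by rw [Matrix.trace_add, h2, h4, add_zero]⟩
  zero_mem' := ⟨by simp, by simp⟩
  smul_mem' := by
    rintro c X ⟨h1, h2⟩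
    exact ⟨by rw [star_smul, h1, star_trivial, smul_neg], by rw [Matrix.trace_smul, h2, smul_zero]⟩

/-- `p₁ = ½ (0, 1; -1, 0)`. -/
def p₁ : su2 := ⟨(1 / 2 : ℝ) • !![0, 1; -1, 0], by
  refine su2.smul_mem _ ⟨?_, ?_⟩
  · ext i j; fin_cases i <;> fin_cases j <;> simp [Matrix.star_apply]
  · simp [Matrix.trace_fin_two]⟩

/-- `p₂ = ½ (0, i; i, 0)`. -/
def p₂ : su2 := ⟨(1 / 2 : ℝ) • !![0, Complex.I; Complex.I, 0], by
  refine su2.smul_mem _ ⟨?_, ?_⟩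
  · ext i j; fin_cases i <;> fin_cases j <;> simp [Matrix.star_apply]
  · simp [Matrix.trace_fin_two]⟩

theorem exp_mul_exp_neg (X : Mat2) : NormedSpace.exp X * NormedSpace.exp (-X) = 1 := by
  rw [← Matrix.exp_add_of_commute _ _ (Commute.refl X).neg_right, add_neg_cancel,
    NormedSpace.exp_zero]

theorem exp_mem_SU2 (X : su2) : NormedSpace.exp (X : Mat2) ∈ SU2 := by
  obtain ⟨hX, htr⟩ := X.2
  generalize (X : Mat2) = X at hX htr ⊢
  rw [Matrix.mem_specialUnitaryGroup_iff, Matrix.mem_unitaryGroup_iff]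
  constructor
  · rw [Matrix.star_eq_conjTranspose, ← Matrix.exp_conjTranspose, ← Matrix.star_eq_conjTranspose,
      hX, exp_mul_exp_neg]
  · have hJ : (!![0, 1; -1, 0] : Mat2) * !![0, -1; 1, 0] = 1 := by
      ext i j; fin_cases i <;> fin_cases j <;> simp
    have hinv : (!![0, 1; -1, 0] : Mat2)⁻¹ = !![0, -1; 1, 0] := Matrix.inv_eq_right_inv hJ
    have hadj : ∀ A : Mat2, !![0, 1; -1, 0] * A.transpose * (!![0, 1; -1, 0] : Mat2)⁻¹ =
        A.adjugate := fun A => by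
      rw [hinv, Matrix.adjugate_fin_two, Matrix.eta_fin_two A.transpose]
      ext i j; fin_cases i <;> fin_cases j <;> simp
    have hXadj : Matrix.adjugate X = -X := by
      rw [Matrix.trace_fin_two] at htr
      rw [Matrix.adjugate_fin_two]
      ext i j; fin_cases i <;> fin_cases j <;> simp
      · linear_combination htr
      · linear_combination htr
    have h := Matrix.exp_conj !![0, 1; -1, 0] X.transpose (IsUnit.of_mul_eq_one _ hJ)
    rw [hadj, hXadj, Matrix.exp_transpose, hadj] at h
    have h2 := Matrix.mul_adjugate (NormedSpace.exp X)
    rw [← h, exp_mul_exp_neg] at h2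
    have := congrFun (congrFun h2 0) 0
    simpa using this.symm

/-- The exponential map `su(2) → SU(2)` (matrix exponential). -/
def expSU2 (X : su2) : SU2 := ⟨NormedSpace.exp (X : Mat2), exp_mem_SU2 X⟩

theorem expSU2_pi_p₂ : (expSU2 (Real.pi • p₂) : Mat2) = !![0, Complex.I; Complex.I, 0] := by
  have hU : (!![1, 1; 1, -1] : Mat2) * ((1 / 2 : ℂ) • !![1, 1; 1, -1]) = 1 := by
    ext i j; fin_cases i <;> fin_cases j <;> norm_num [Matrix.mul_apply, Fin.sum_univ_two]
  have hinv : (!![1, 1; 1, -1] : Mat2)⁻¹ = (1 / 2 : ℂ) • !![1, 1; 1, -1] :=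
    Matrix.inv_eq_right_inv hU
  have hd : ∀ a b : ℂ, Matrix.diagonal ![a, b] = !![a, 0; 0, b] := fun a b => by
    ext i j; fin_cases i <;> fin_cases j <;> simp
  have h := Matrix.exp_conj (!![1, 1; 1, -1] : Mat2)
    (Matrix.diagonal ![Real.pi / 2 * Complex.I, -(Real.pi / 2 * Complex.I)])
    (IsUnit.of_mul_eq_one _ hU)
  have he : NormedSpace.exp ![Real.pi / 2 * Complex.I, -(Real.pi / 2 * Complex.I)] =
      ![Complex.I, -Complex.I] := by
    rw [Pi.exp_def]
    ext i; fin_cases i <;>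
      simp [← Complex.exp_eq_exp_ℂ, Complex.exp_neg, Complex.exp_pi_div_two_mul_I]
  rw [Matrix.exp_diagonal, hinv, he, hd, hd] at h
  have h1 : ((Real.pi • p₂ : su2) : Mat2) = !![1, 1; 1, -1] *
      !![Real.pi / 2 * Complex.I, 0; 0, -(Real.pi / 2 * Complex.I)] *
      ((1 / 2 : ℂ) • !![1, 1; 1, -1]) := by
    ext i j; fin_cases i <;> fin_cases j <;> simp [p₂] <;> ring
  change NormedSpace.exp ((Real.pi • p₂ : su2) : Mat2) = _
  rw [h1, h]
  ext i j; fin_cases i <;> fin_cases j <;> simp <;> ring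

/-! ### The lens space `L(4,1)` -/

/-- The cyclic group of order four generated by `e^{π p₂}`. -/
def lensSubgroup : Subgroup SU2 := Subgroup.zpowers (expSU2 (Real.pi • p₂))

theorem finite_lensSubgroup : Finite lensSubgroup := by
  have h : expSU2 (Real.pi • p₂) ^ 4 = 1 := by
    apply Subtype.ext
    change (expSU2 (Real.pi • p₂) : Mat2) ^ 4 = 1
    rw [expSU2_pi_p₂]
    have h2 : (!![0, Complex.I; Complex.I, 0] : Mat2) ^ 2 = -1 := by
      rw [sq]; ext i j; fin_cases i <;> fin_cases j <;> simp
    rw [show (4 : ℕ) = 2 * 2 from rfl, pow_mul, h2]; simp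
  have := isOfFinOrder_iff_pow_eq_one.2 ⟨4, by norm_num, h⟩
  exact this.finite_zpowers

/-- The lens space `L(4,1)` as the quotient of `SU(2)` identifying
`e^{-b p₂} e^{a p₁} e^{c p₂}` with `e^{-b p₂} e^{a p₁} e^{(c + kπ) p₂}` for all integers `k`,
that is, `g` with `g h` for `h` in the cyclic group generated by `e^{π p₂}`. -/
abbrev L41 := SU2 ⧸ lensSubgroup

/-- The quotient map `Π : SU(2) → L(4,1)`. -/
def lensProj : SU2 → L41 := QuotientGroup.mk

theorem isLocalHomeomorph_lensProj : IsLocalHomeomorph lensProj :=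
  (lensSubgroup.isQuotientCoveringMap
    (@Set.toFinite _ (lensSubgroup : Set SU2) finite_lensSubgroup).isDiscrete).isCoveringMap.isLocalHomeomorph

theorem contMDiff_mul_right (h : SU2) : ContMDiff (𝓡 3) (𝓡 3) ∞ (fun g : SU2 => g * h) := by
  have : Fact (Module.finrank ℝ (EuclideanSpace ℝ (Fin 4)) = 3 + 1) :=
    ⟨finrank_euclideanSpace_fin⟩
  have hG : ∀ x : sphere (0 : EuclideanSpace ℝ (Fin 4)) 1,
      ((sphereHomeoSU2.symm (sphereHomeoSU2 x * h) : sphere (0 : EuclideanSpace ℝ (Fin 4)) 1) :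
        EuclideanSpace ℝ (Fin 4)) = WithLp.toLp 2
      ![x.1 0 * (h.1 0 0).re - x.1 1 * (h.1 0 0).im + (x.1 2 * (h.1 1 0).re - x.1 3 * (h.1 1 0).im),
        x.1 0 * (h.1 0 0).im + x.1 1 * (h.1 0 0).re + (x.1 2 * (h.1 1 0).im + x.1 3 * (h.1 1 0).re),
        x.1 0 * (h.1 0 1).re - x.1 1 * (h.1 0 1).im + (x.1 2 * (h.1 1 1).re - x.1 3 * (h.1 1 1).im),
        x.1 0 * (h.1 0 1).im + x.1 1 * (h.1 0 1).re +
          (x.1 2 * (h.1 1 1).im + x.1 3 * (h.1 1 1).re)] := by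
    intro x
    change WithLp.toLp 2 _ = _
    congr 1
    ext i
    fin_cases i <;>
      simp [sphereHomeoSU2, quatMatrix, Matrix.mul_apply, Fin.sum_univ_two]
  have hs : ContMDiff (𝓡 3) (𝓡 3) ∞ (fun x : sphere (0 : EuclideanSpace ℝ (Fin 4)) 1 =>
      sphereHomeoSU2.symm (sphereHomeoSU2 x * h)) := by
    have hc : ContMDiff (𝓡 3) 𝓘(ℝ, EuclideanSpace ℝ (Fin 4)) ∞
        (fun x : sphere (0 : EuclideanSpace ℝ (Fin 4)) 1 =>
          ((sphereHomeoSU2.symm (sphereHomeoSU2 x * h) :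
            sphere (0 : EuclideanSpace ℝ (Fin 4)) 1) : EuclideanSpace ℝ (Fin 4))) := by
      simp_rw [hG]
      have hx : ContMDiff (𝓡 3) 𝓘(ℝ, EuclideanSpace ℝ (Fin 4)) ∞
        (fun x : sphere (0 : EuclideanSpace ℝ (Fin 4)) 1 => x.1) := contMDiff_coe_sphere
      refine ContDiff.comp_contMDiff (g := fun x : EuclideanSpace ℝ (Fin 4) => WithLp.toLp 2
      ![x 0 * (h.1 0 0).re - x 1 * (h.1 0 0).im + (x 2 * (h.1 1 0).re - x 3 * (h.1 1 0).im),
        x 0 * (h.1 0 0).im + x 1 * (h.1 0 0).re + (x 2 * (h.1 1 0).im + x 3 * (h.1 1 0).re),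
        x 0 * (h.1 0 1).re - x 1 * (h.1 0 1).im + (x 2 * (h.1 1 1).re - x 3 * (h.1 1 1).im),
        x 0 * (h.1 0 1).im + x 1 * (h.1 0 1).re +
          (x 2 * (h.1 1 1).im + x 3 * (h.1 1 1).re)]) ?_ hx
      rw [contDiff_euclidean]
      intro i
      fin_cases i <;> simp <;> fun_prop
    exact hc.codRestrict_sphere fun x => (sphereHomeoSU2.symm _).2
  have := ((contMDiff_homeomorph sphereHomeoSU2 (I := 𝓡 3)).comp hs).comp
    (contMDiff_homeomorph_symm sphereHomeoSU2 (I := 𝓡 3))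
  refine this.congr fun g => ?_
  simp

/-- The quotient smooth structure: the charts are those of `SU(2)` composed with local inverses of
the quotient map. -/
instance : ChartedSpace E3 L41 :=
  isLocalHomeomorph_lensProj.chartedSpace QuotientGroup.mk_surjective

instance : IsManifold (𝓡 3) ∞ L41 :=
  isManifold_of_deck isLocalHomeomorph_lensProj QuotientGroup.mk_surjective fun x y h => by
    have hm : x⁻¹ * y ∈ lensSubgroup := QuotientGroup.eq.1 h
    refine ⟨fun g => g * (x⁻¹ * y), by simp, (contMDiff_mul_right _).contMDiffAt, fun z => ?_⟩
    exact QuotientGroup.mk_mul_of_mem z hm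


/-! ### The bundle of (unoriented) directions of a surface -/

/-- The bundle of directions `PTM` of a smooth surface `M`: a point is a point `base` of `M`
together with a point `dir` of the projective space of the tangent plane at `base`. -/
structure ProjTangent (M : Type*) [TopologicalSpace M] [ChartedSpace E2 M] where
  base : M
  dir : ℙ ℝ (TangentSpace (𝓡 2) base)

/-- The vector of the plane with `j`-th coordinate `1` and other coordinate `s`. -/
def slopeVec (j : Fin 2) (s : ℝ) : E2 := WithLp.toLp 2 (fun i => if i = j then 1 else s)

/-- The slope of `w` relative to the `j`-th axis: the affine coordinate, defined where `w j ≠ 0`,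
of the line through `w` on the projective line. -/
def slope (j : Fin 2) (w : E2) : ℝ := w (j + 1) / w j

/-- The line through `v` (an arbitrary line if `v = 0`). -/
def direction (v : E2) : ℙ ℝ E2 :=
  open Classical in
  if h : v ≠ 0 then Projectivization.mk ℝ v h
  else Projectivization.mk ℝ (slopeVec 0 0) (fun h => by
    have := congrArg (fun w : E2 => w 0) h
    simp [slopeVec] at this)

theorem slopeVec_self (j : Fin 2) (s : ℝ) : slopeVec j s j = 1 := by simp [slopeVec]

theorem slopeVec_other (j : Fin 2) (s : ℝ) : slopeVec j s (j + 1) = s := by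
  fin_cases j <;> simp [slopeVec]

theorem slopeVec_ne_zero (j : Fin 2) (s : ℝ) : slopeVec j s ≠ 0 := fun h => by
  have := congrArg (fun w : E2 => w j) h
  simp [slopeVec] at this

theorem slope_slopeVec (j : Fin 2) (s : ℝ) : slope j (slopeVec j s) = s := by
  rw [slope, slopeVec_self, slopeVec_other, div_one]

theorem slope_smul (j : Fin 2) {a : ℝ} (ha : a ≠ 0) (w : E2) : slope j (a • w) = slope j w := by
  simp only [slope, PiLp.smul_apply, smul_eq_mul]
  exact mul_div_mul_left _ _ ha

theorem slopeVec_slope (j : Fin 2) {w : E2} (hw : w j ≠ 0) :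
    slopeVec j (slope j w) = (w j)⁻¹ • w := by
  ext i
  have : i = j ∨ i = j + 1 := by fin_cases i <;> fin_cases j <;> simp
  rcases this with rfl | rfl
  · simp [slopeVec_self, hw]
  · rw [slopeVec_other, slope]; simp [div_eq_inv_mul]

theorem exists_rep_direction {v : E2} (hv : v ≠ 0) :
    ∃ a : ℝ, a ≠ 0 ∧ (direction v).rep = a • v := by
  obtain ⟨a, ha⟩ := Projectivization.exists_smul_eq_mk_rep ℝ v hv
  refine ⟨a, a.ne_zero, ?_⟩
  rw [direction, dif_pos hv, ← ha]
  rfl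

theorem direction_smul {a : ℝ} (ha : a ≠ 0) {v : E2} (hv : v ≠ 0) :
    direction (a • v) = direction v := by
  rw [direction, direction, dif_pos hv, dif_pos (smul_ne_zero ha hv)]
  rw [Projectivization.mk_eq_mk_iff']
  exact ⟨a, rfl⟩

theorem direction_rep (l : ℙ ℝ E2) : direction l.rep = l := by
  rw [direction, dif_pos l.rep_nonzero, Projectivization.mk_rep]

variable {M : Type*} [TopologicalSpace M] [ChartedSpace E2 M]

section
variable [IsManifold (𝓡 2) ∞ M]

theorem coordChange_inv {x y z : M} (h : z ∈ (extChartAt (𝓡 2) x).source)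
    (h' : z ∈ (extChartAt (𝓡 2) y).source) (v : E2) :
    tangentCoordChange (𝓡 2) y x z (tangentCoordChange (𝓡 2) x y z v) = v := by
  rw [tangentCoordChange_comp ⟨⟨h, h'⟩, h⟩, tangentCoordChange_self h]

theorem coordChange_ne_zero {x y z : M} (h : z ∈ (extChartAt (𝓡 2) x).source)
    (h' : z ∈ (extChartAt (𝓡 2) y).source) {v : E2} (hv : v ≠ 0) :
    tangentCoordChange (𝓡 2) x y z v ≠ 0 := fun h0 => hv <| by
  rw [← coordChange_inv h h' v, h0, map_zero]

/-- A vector spanning the direction `q`, read in the coordinates of the chart of `M` at `x₀`.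
(The tangent space at `x` is read by Mathlib in the preferred chart at `x`.) -/
def coordRep (x₀ : M) (q : ProjTangent M) : E2 :=
  tangentCoordChange (𝓡 2) q.base x₀ q.base q.dir.rep

/-- The inverse of the lifted chart. -/
def projChartInv (x₀ : M) (j : Fin 2) (y : E2 × ℝ) : ProjTangent M where
  base := (extChartAt (𝓡 2) x₀).symm y.1
  dir := direction (tangentCoordChange (𝓡 2) x₀ ((extChartAt (𝓡 2) x₀).symm y.1)
    ((extChartAt (𝓡 2) x₀).symm y.1) (slopeVec j y.2))

theorem coordRep_projChartInv (x₀ x₁ : M) (j : Fin 2) (y : E2 × ℝ)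
    (hy : y.1 ∈ (extChartAt (𝓡 2) x₀).target)
    (h1 : (extChartAt (𝓡 2) x₀).symm y.1 ∈ (extChartAt (𝓡 2) x₁).source) :
    ∃ a : ℝ, a ≠ 0 ∧ coordRep x₁ (projChartInv x₀ j y) =
      a • tangentCoordChange (𝓡 2) x₀ x₁ ((extChartAt (𝓡 2) x₀).symm y.1) (slopeVec j y.2) := by
  have h0 := (extChartAt (𝓡 2) x₀).map_target hy
  have hx := mem_extChartAt_source (I := 𝓡 2) ((extChartAt (𝓡 2) x₀).symm y.1)
  obtain ⟨a, ha, h⟩ := exists_rep_direction (coordChange_ne_zero h0 hx (slopeVec_ne_zero j y.2))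
  refine ⟨a, ha, ?_⟩
  rw [coordRep]
  erw [h]
  rw [map_smul, ← tangentCoordChange_comp ⟨⟨h0, hx⟩, h1⟩]
  rfl

/-- The chart of `PTM` lifted from the chart of `M` at `x₀`: the coordinates of the base point,
followed by the affine coordinate (slope relative to the `j`-th axis) of the direction, the
direction being read in the coordinates of the chart at `x₀`. -/
def projChart (x₀ : M) (j : Fin 2) : PartialEquiv (ProjTangent M) (E2 × ℝ) where
  toFun q := (extChartAt (𝓡 2) x₀ q.base, slope j (coordRep x₀ q))
  invFun := projChartInv x₀ j
  source := {q | q.base ∈ (extChartAt (𝓡 2) x₀).source ∧ coordRep x₀ q j ≠ 0}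
  target := (extChartAt (𝓡 2) x₀).target ×ˢ univ
  map_source' q hq := ⟨(extChartAt (𝓡 2) x₀).map_source hq.1, trivial⟩
  map_target' y hy := by
    have h0 := (extChartAt (𝓡 2) x₀).map_target hy.1
    refine ⟨h0, ?_⟩
    obtain ⟨a, ha, h⟩ := coordRep_projChartInv x₀ x₀ j y hy.1 h0
    rw [h, tangentCoordChange_self h0, PiLp.smul_apply, slopeVec_self]
    simpa using ha
  left_inv' := by
    rintro ⟨x, l⟩ ⟨h0, h⟩
    have hx := mem_extChartAt_source (I := 𝓡 2) x
    simp only at h0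
    have key : ∀ x' : M, x' = x → (⟨x', direction (tangentCoordChange (𝓡 2) x₀ x' x'
        (slopeVec j (slope j (coordRep x₀ ⟨x, l⟩))))⟩ : ProjTangent M) = ⟨x, l⟩ := by
      rintro x' rfl
      congr 1
      rw [slopeVec_slope j h, map_smul, coordRep]
      erw [coordChange_inv hx h0]
      exact (direction_smul (inv_ne_zero h) l.rep_nonzero).trans (direction_rep l)
    exact key _ ((extChartAt (𝓡 2) x₀).left_inv h0)
  right_inv' y hy := by
    have h0 := (extChartAt (𝓡 2) x₀).map_target hy.1
    obtain ⟨a, ha, h⟩ := coordRep_projChartInv x₀ x₀ j y hy.1 h0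
    refine Prod.ext ((extChartAt (𝓡 2) x₀).right_inv hy.1) ?_
    simp only
    rw [h, slope_smul _ ha, tangentCoordChange_self h0, slope_slopeVec]

/-- The change of coordinates between two lifted charts. -/
def projTransition (x₀ x₁ : M) (j k : Fin 2) (y : E2 × ℝ) : E2 × ℝ :=
  (extChartAt (𝓡 2) x₁ ((extChartAt (𝓡 2) x₀).symm y.1),
    slope k (tangentCoordChange (𝓡 2) x₀ x₁ ((extChartAt (𝓡 2) x₀).symm y.1) (slopeVec j y.2)))

theorem projChart_trans_source (x₀ x₁ : M) (j k : Fin 2) :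
    ((projChart x₀ j).symm.trans (projChart x₁ k)).source =
      {y | y.1 ∈ ((extChartAt (𝓡 2) x₀).symm.trans (extChartAt (𝓡 2) x₁)).source ∧
        tangentCoordChange (𝓡 2) x₀ x₁ ((extChartAt (𝓡 2) x₀).symm y.1) (slopeVec j y.2) k ≠ 0} := by
  ext y
  constructor
  · rintro ⟨hy, h1, h⟩
    refine ⟨⟨hy.1, h1⟩, fun h0 => h ?_⟩
    obtain ⟨a, ha, h'⟩ := coordRep_projChartInv x₀ x₁ j y hy.1 h1
    change coordRep x₁ (projChartInv x₀ j y) k = 0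
    rw [h', PiLp.smul_apply, h0, smul_zero]
  · rintro ⟨⟨hy, h1⟩, h⟩
    refine ⟨⟨hy, trivial⟩, h1, ?_⟩
    obtain ⟨a, ha, h'⟩ := coordRep_projChartInv x₀ x₁ j y hy h1
    change coordRep x₁ (projChartInv x₀ j y) k ≠ 0
    rw [h', PiLp.smul_apply]
    exact smul_ne_zero ha h

theorem projChart_trans_eqOn (x₀ x₁ : M) (j k : Fin 2) :
    EqOn ((projChart x₀ j).symm.trans (projChart x₁ k)) (projTransition x₀ x₁ j k)
      ((projChart x₀ j).symm.trans (projChart x₁ k)).source := by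
  rintro y ⟨hy, h1, -⟩
  obtain ⟨a, ha, h⟩ := coordRep_projChartInv x₀ x₁ j y hy.1 h1
  refine Prod.ext rfl ?_
  change slope k (coordRep x₁ (projChartInv x₀ j y)) = _
  rw [h, slope_smul k ha]
  rfl

theorem contDiffOn_coordChange (x₀ x₁ : M) (j : Fin 2) :
    ContDiffOn ℝ ∞ (fun y : E2 × ℝ =>
        tangentCoordChange (𝓡 2) x₀ x₁ ((extChartAt (𝓡 2) x₀).symm y.1) (slopeVec j y.2))
      (((extChartAt (𝓡 2) x₀).symm.trans (extChartAt (𝓡 2) x₁)).source ×ˢ univ) := by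
  have h1 : ContDiffOn ℝ ∞
      (fderivWithin ℝ (extChartAt (𝓡 2) x₁ ∘ (extChartAt (𝓡 2) x₀).symm) (range (𝓡 2)))
      ((extChartAt (𝓡 2) x₀).symm.trans (extChartAt (𝓡 2) x₁)).source :=
    haveI : IsManifold (𝓡 2) (∞ + 1) M := inferInstanceAs (IsManifold (𝓡 2) ∞ M)
    contDiffOn_fderiv_coord_change (I := 𝓡 2) (n := ∞) (achart E2 x₀) (achart E2 x₁)
  have h2 : ContDiff ℝ ∞ (fun y : E2 × ℝ => slopeVec j y.2) := by
    rw [contDiff_euclidean]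
    intro i
    simp only [slopeVec]
    split_ifs
    · exact contDiff_const
    · exact contDiff_snd
  refine ((h1.comp contDiffOn_fst fun y hy => hy.1).clm_apply h2.contDiffOn).congr ?_
  intro y hy
  rw [tangentCoordChange_def, (extChartAt (𝓡 2) x₀).right_inv hy.1.1]
  rfl

theorem contDiffOn_projTransition (x₀ x₁ : M) (j k : Fin 2) :
    ContDiffOn ℝ ∞ (projTransition x₀ x₁ j k)
      ((projChart x₀ j).symm.trans (projChart x₁ k)).source := by
  rw [projChart_trans_source]
  have h1 : ContDiffOn ℝ ∞ (extChartAt (𝓡 2) x₁ ∘ (extChartAt (𝓡 2) x₀).symm)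
      ((extChartAt (𝓡 2) x₀).symm.trans (extChartAt (𝓡 2) x₁)).source :=
    fun y hy => (contDiffWithinAt_ext_coord_change x₁ x₀ hy).mono_of_mem_nhdsWithin (by simp)
  refine ContDiffOn.prodMk (h1.comp contDiffOn_fst fun y hy => hy.1) ?_
  have h2 := (contDiffOn_euclidean.1 (contDiffOn_coordChange x₀ x₁ j))
  have hs : {y : E2 × ℝ | y.1 ∈ ((extChartAt (𝓡 2) x₀).symm.trans (extChartAt (𝓡 2) x₁)).source ∧
      tangentCoordChange (𝓡 2) x₀ x₁ ((extChartAt (𝓡 2) x₀).symm y.1) (slopeVec j y.2) k ≠ 0} ⊆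
      ((extChartAt (𝓡 2) x₀).symm.trans (extChartAt (𝓡 2) x₁)).source ×ˢ univ := fun y hy => ⟨hy.1, trivial⟩
  exact ((h2 (k + 1)).mono hs).div ((h2 k).mono hs) fun y hy => hy.2

theorem isOpen_projChart_trans_source (x₀ x₁ : M) (j k : Fin 2) :
    IsOpen ((projChart x₀ j).symm.trans (projChart x₁ k)).source := by
  have h0 : IsOpen (((extChartAt (𝓡 2) x₀).symm.trans (extChartAt (𝓡 2) x₁)).source ×ˢ
      (univ : Set ℝ)) := by
    refine IsOpen.prod ?_ isOpen_univ
    have := ((chartAt E2 x₀).symm.trans (chartAt E2 x₁)).open_source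
    simpa [extChartAt, OpenPartialHomeomorph.extend] using this
  have h1 := (contDiffOn_euclidean.1 (contDiffOn_coordChange x₀ x₁ j) k).continuousOn
  have := h1.isOpen_inter_preimage h0 (isOpen_compl_singleton (x := (0 : ℝ)))
  rw [projChart_trans_source]
  convert! this using 1
  ext y
  simp only [mem_ofPred_eq, mem_inter_iff, mem_prod, mem_univ, and_true, mem_preimage,
    mem_compl_iff, mem_singleton_iff, ne_eq]

theorem exists_projChart (q : ProjTangent M) : ∃ j, q ∈ (projChart q.base j).source := by
  by_contra! h
  have hq := mem_extChartAt_source (I := 𝓡 2) q.base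
  refine coordChange_ne_zero hq hq q.dir.rep_nonzero ?_
  ext i
  by_contra hi
  exact h i ⟨hq, hi⟩

variable (M) in
/-- The atlas of lifted charts; it defines the topology and the smooth structure of `PTM`. -/
def projCore : ChartedSpaceCore (E2 × ℝ) (ProjTangent M) where
  atlas := {e | ∃ x₀ j, e = projChart x₀ j}
  chartAt q := projChart q.base (exists_projChart q).choose
  mem_chart_source q := (exists_projChart q).choose_spec
  chart_mem_atlas q := ⟨_, _, rfl⟩
  open_source := by
    rintro _ _ ⟨x₀, j, rfl⟩ ⟨x₁, k, rfl⟩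
    exact isOpen_projChart_trans_source x₀ x₁ j k
  continuousOn_toFun := by
    rintro _ _ ⟨x₀, j, rfl⟩ ⟨x₁, k, rfl⟩
    exact (contDiffOn_projTransition x₀ x₁ j k).continuousOn.congr (projChart_trans_eqOn x₀ x₁ j k)

instance : TopologicalSpace (ProjTangent M) := (projCore M).toTopologicalSpace

instance : ChartedSpace (E2 × ℝ) (ProjTangent M) := (projCore M).toChartedSpace

instance : IsManifold 𝓘(ℝ, E2 × ℝ) ∞ (ProjTangent M) := by
  refine isManifold_of_contDiffOn _ _ _ ?_
  intro e e' he he'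
  obtain ⟨_, ⟨x₀, j, rfl⟩, rfl⟩ := mem_iUnion₂.1 he
  obtain ⟨_, ⟨x₁, k, rfl⟩, rfl⟩ := mem_iUnion₂.1 he'
  have := (contDiffOn_projTransition x₀ x₁ j k).congr (projChart_trans_eqOn x₀ x₁ j k)
  exact this.mono fun y hy => hy.1

end
/-! ### Horizontal curves and length -/

section Curves
variable {E : Type*} [NormedAddCommGroup E] [NormedSpace ℝ E] {H : Type*} [TopologicalSpace H]
  (I : ModelWithCorners ℝ E H) {M : Type*} [TopologicalSpace M] [ChartedSpace H M]

/-- The velocity at time `t` of a curve defined on `[0, T]`. -/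
def velocity (T : ℝ) (γ : ℝ → M) (t : ℝ) : TangentSpace I (γ t) :=
  mfderivWithin 𝓘(ℝ, ℝ) I γ (Icc 0 T) t (1 : ℝ)

/-- Lipschitz curves `[0, T] → M`: continuous, and Lipschitz in charts near every time. -/
def IsLipschitzCurve (T : ℝ) (γ : ℝ → M) : Prop :=
  ∀ t ∈ Icc 0 T, ContinuousWithinAt γ (Icc 0 T) t ∧
    ∃ K : ℝ≥0, ∃ s ∈ 𝓝[Icc 0 T] t, LipschitzOnWith K (extChartAt I (γ t) ∘ γ) s

/-- Horizontal curves of a distribution `Δ`: Lipschitz curves whose velocity is in `Δ` at almost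
every time (a Lipschitz curve has a velocity at almost every time). -/
def IsHorizontal (Δ : ∀ q : M, Submodule ℝ (TangentSpace I q)) (T : ℝ) (γ : ℝ → M) : Prop :=
  IsLipschitzCurve I T γ ∧ ∀ᵐ t ∂(volume.restrict (Icc 0 T)), velocity I T γ t ∈ Δ (γ t)

/-- The length `∫₀ᵀ N(γ'(t)) dt`, where `N` is the norm of a sub-Riemannian structure. -/
def curveLength (N : ∀ q : M, TangentSpace I q → ℝ) (T : ℝ) (γ : ℝ → M) : ENNReal :=
  ∫⁻ t in Icc 0 T, ENNReal.ofReal (N (γ t) (velocity I T γ t))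

end Curves

/-! ### The sub-Riemannian structures of `SU(2)` and `L(4,1)` -/

/-- The left-invariant form `v ↦ g⁻¹ v`, a tangent vector `v` of `SU(2)` at `g` being seen as a
matrix. -/
def leftTrivialization (g : SU2) : TangentSpace (𝓡 3) g →ₗ[ℝ] Mat2 where
  toFun v := ((g⁻¹ : SU2) : Mat2) *
    Matrix.of fun i j => mvfderiv (𝓡 3) (fun h : SU2 => (h : Mat2) i j) g v
  map_add' v w := by
    rw [← mul_add]
    congr 1
    ext i j
    simp
  map_smul' c v := by
    rw [RingHom.id_apply, ← Matrix.mul_smul]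
    congr 1
    ext i j
    simp

/-- The subspace `𝐩` of `su(2)` spanned by `p₁` and `p₂`. -/
def pSpace : Submodule ℝ Mat2 := Submodule.span ℝ {(p₁ : Mat2), (p₂ : Mat2)}

/-- The Killing form of `su(2)`. -/
def killing (X Y : Mat2) : ℝ := 4 * (Matrix.trace (X * Y)).re

/-- The distribution `Δ(g) = g 𝐩` on `SU(2)`. -/
def distSU2 (g : SU2) : Submodule ℝ (TangentSpace (𝓡 3) g) := pSpace.comap (leftTrivialization g)

/-- The metric `⟨g⁻¹ v, g⁻¹ w⟩` on `SU(2)`, with `⟨X, Y⟩ = -½ Kil(X, Y)`. -/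
def metricSU2 (g : SU2) (v w : TangentSpace (𝓡 3) g) : ℝ :=
  -(1 / 2) * killing (leftTrivialization g v) (leftTrivialization g w)

/-- The differential of the quotient map `Π` at a representative `h` of `q`. -/
def dLensProj (q : L41) : TangentSpace (𝓡 3) (Quotient.out q) →L[ℝ] TangentSpace (𝓡 3) q :=
  mfderiv (𝓡 3) (𝓡 3) lensProj (Quotient.out q)

/-- The distribution `Δ̃([h]) = Π_*(Δ(h))` on `L(4,1)` (independent of the representative `h`). -/
def distL41 (q : L41) : Submodule ℝ (TangentSpace (𝓡 3) q) :=
  (distSU2 (Quotient.out q)).map (dLensProj q : _ →ₗ[ℝ] TangentSpace (𝓡 3) q)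

/-- The metric on `Δ̃([h])` for which `Π_*` is an isometry (independent of the representative). -/
def metricL41 (q : L41) (v w : TangentSpace (𝓡 3) q) : ℝ :=
  metricSU2 (Quotient.out q) ((dLensProj q).inverse v) ((dLensProj q).inverse w)

/-- The sub-Riemannian norm on `L(4,1)`. -/
def normL41 (q : L41) (v : TangentSpace (𝓡 3) q) : ℝ := √(metricL41 q v v)

/-- The point `e^{-b p₂} e^{a p₁} e^{c p₂}` of `SU(2)`, with coordinates `(a, b, c)`. -/
def eulerSU2 (a b c : ℝ) : SU2 := expSU2 (-(b • p₂)) * expSU2 (a • p₁) * expSU2 (c • p₂)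

/-! ### The bundle of directions of the sphere -/

/-- The unit sphere `S²` of `ℝ³`. -/
abbrev S2 := sphere (0 : E3) 1

/-- The bundle of directions of `S²`. -/
abbrev PTS2 := ProjTangent S2

/-- The tangent vector `v` of `S²` seen as a vector of `ℝ³`; the standard Riemannian metric of `S²`
is the one for which this is isometric. -/
def toAmbient (x : S2) : TangentSpace (𝓡 2) x →L[ℝ] E3 := mvfderiv (𝓡 2) (fun y : S2 => (y : E3)) x

/-- The direction `q`, seen as a line in `ℝ³`, orthogonal to the base point. -/
def line (q : PTS2) : Submodule ℝ E3 :=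
  q.dir.submodule.map (toAmbient q.base : TangentSpace (𝓡 2) q.base →ₗ[ℝ] E3)

/-- The contact distribution of `PTS²`: the tangent vectors at `q` whose projection to `S²` belongs
to the direction `q`. -/
def distPTS2 (q : PTS2) : Submodule ℝ (TangentSpace 𝓘(ℝ, E2 × ℝ) q) :=
  q.dir.submodule.comap
    (mfderiv 𝓘(ℝ, E2 × ℝ) (𝓡 2) (ProjTangent.base : PTS2 → S2) q :
      TangentSpace 𝓘(ℝ, E2 × ℝ) q →ₗ[ℝ] TangentSpace (𝓡 2) q.base)

/-- One of the two unit vectors of the direction `q`. -/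
def unitVec (q : PTS2) : E3 := ‖toAmbient q.base q.dir.rep‖⁻¹ • toAmbient q.base q.dir.rep

/-- The unit vector of the direction `r` on the same side as `u` (if `u` is not orthogonal to the
line `r`): the normalized projection of `u` to the line. -/
def unitToward (u : E3) (r : PTS2) : E3 :=
  ‖(line r).starProjection u‖⁻¹ • (line r).starProjection u

/-- The covariant derivative in `S²`, along the tangent vector `V` of `PTS²` at `q`, of the unit
vector of the direction: the component orthogonal to the base point of its derivative in `ℝ³`.
It is defined up to sign. -/
def covDerivUnit (q : PTS2) (V : TangentSpace 𝓘(ℝ, E2 × ℝ) q) : E3 :=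
  mvfderiv 𝓘(ℝ, E2 × ℝ) (unitToward (unitVec q)) q V -
    ⟪(q.base : E3), mvfderiv 𝓘(ℝ, E2 × ℝ) (unitToward (unitVec q)) q V⟫ • (q.base : E3)

/-- The norm `√(u₁² + β² u₂²)` on the distribution of `PTS²`, where `u₁` is the velocity of the base
point and `u₂` the angular velocity of the direction with respect to parallel transport. At a time
when the base curve is regular, `|u₂|` is the absolute value of its geodesic curvature times `|u₁|`,
so that this is the integrand `√(g(γ', γ') + β² K² g(γ', γ'))`. In the lifted spherical chart
`u₁² = ȧ² + sin² a ḃ²` and `u₂ = ξ̇ + cos a ḃ`. -/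
def normPTS2 (β : ℝ) (q : PTS2) (V : TangentSpace 𝓘(ℝ, E2 × ℝ) q) : ℝ :=
  √(‖mvfderiv 𝓘(ℝ, E2 × ℝ) (fun r : PTS2 => (r.base : E3)) q V‖ ^ 2 +
    β ^ 2 * ‖covDerivUnit q V‖ ^ 2)

/-- The point of `S²` with spherical coordinates `(a, b)`. -/
def sphericalPoint (a b : ℝ) : E3 :=
  !₂[Real.sin a * Real.cos b, Real.sin a * Real.sin b, Real.cos a]

/-- The unit vector `∂_a`. -/
def frameA (a b : ℝ) : E3 := !₂[Real.cos a * Real.cos b, Real.cos a * Real.sin b, -Real.sin a]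

/-- The unit vector `∂_b / ‖∂_b‖`. -/
def frameB (b : ℝ) : E3 := !₂[-Real.sin b, Real.cos b, 0]

/-- The direction `q` has coordinates `(a, b, ξ)`: its base point has spherical coordinates `(a, b)`
and it makes the angle `ξ` with `∂_a`. -/
def HasCoords (q : PTS2) (a b ξ : ℝ) : Prop :=
  (q.base : E3) = sphericalPoint a b ∧
    line q = Submodule.span ℝ {Real.cos ξ • frameA a b + Real.sin ξ • frameB b}

/-! ### Curves on the sphere, their lifts and their geodesic curvature -/

/-- `Γ` is on `[0, T]` the lift of a regular `C²` curve `γ` of `S²`: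
`Γ(t)` is the direction of `γ'(t)`. -/
def IsRegularLift (T : ℝ) (Γ : ℝ → PTS2) : Prop :=
  ContMDiffOn 𝓘(ℝ, ℝ) (𝓡 2) 2 (fun t => (Γ t).base) (Icc 0 T) ∧
    ∀ t ∈ Icc 0 T, velocity (𝓡 2) T (fun s => (Γ s).base) t ≠ 0 ∧
      velocity (𝓡 2) T (fun s => (Γ s).base) t ∈ (Γ t).dir.submodule

/-- The geodesic curvature of a curve of `S²` at the point `x`, with velocity `v` and second
derivative `w` in `ℝ³`: the mixed product `(x, v, w)` over `|v|³`. -/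
def geodesicCurvature (x v w : E3) : ℝ :=
  Matrix.det (Matrix.of ![fun i => x i, fun i => v i, fun i => w i]) / ‖v‖ ^ 3

/-- The cost `∫₀ᵀ √(g(γ', γ') + β² K_γ² g(γ', γ')) dt` of a regular curve of `S²`. -/
def curvatureCost (β T : ℝ) (γ : ℝ → S2) : ENNReal :=
  ∫⁻ t in Icc 0 T, ENNReal.ofReal (√(
    ‖derivWithin (fun s => (γ s : E3)) (Icc 0 T) t‖ ^ 2 +
    β ^ 2 * geodesicCurvature (γ t) (derivWithin (fun s => (γ s : E3)) (Icc 0 T) t)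
        (iteratedDerivWithin 2 (fun s => (γ s : E3)) (Icc 0 T) t) ^ 2 *
      ‖derivWithin (fun s => (γ s : E3)) (Icc 0 T) t‖ ^ 2))

end LensPTS

end

open LensPTS

/-!
Identify `SU(2)` with the unit quaternions `x`. Conjugation by `x` carries the orthonormal frame
`(k, i, j)` of the imaginary quaternions to an orthonormal frame of `ℝ³`, written
`(baseVec x, dirVec x, conormalVec x)` in suitable coordinates. The map `toPTS2` sends `x` to the
point `baseVec x` of `S²` together with the line spanned by `dirVec x`. Two unit quaternions have
the same image exactly when they differ by right multiplication by a power of `k = e^{π p₂}`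
(`toPTS2_eq_iff`), and every direction is reached, because spherical coordinates are Euler angles
(`hasCoords_toPTS2`, `toPTS2_surjective`). Hence a bijection `lensEquiv` from `L(4,1)` to `PTS²`.

If `v` is tangent at `g` and `z` is the imaginary quaternion of `g⁻¹ v` (`bodyVelocity`), then along
`v` the base point moves by `2 z₂ dirVec - 2 z₁ conormalVec` and the unit vector of the direction by
`2 z₃ conormalVec` up to a normal component (`mvfderiv_base_toPTS2`, `covDerivUnit_toPTS2`).
Both the distribution of `SU(2)` and that of `PTS²` are therefore `z₁ = 0`, both norms are
`2 √(z₂² + z₃²)` there, and the differential is injective. By the inverse function theorem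
`lensEquiv` is a diffeomorphism, and it preserves horizontality and length because a diffeomorphism
preserves Lipschitz curves and transforms velocities by its differential at every time.

The charts of `PTS²` are handled through `ℝ³`: a map to `PTS²` is smooth as soon as its base point
and some vector field spanning the directions are smooth as maps to `ℝ³`
(`contMDiffWithinAt_PTS2`), and along such a map the unit vector `unitToward` is locally the
normalized field up to a constant sign (`exists_unitToward_eq`). For the lift of a regular curve of
the sphere the field is the velocity `w`, and the tangential part of the derivative of `w / ‖w‖` has
norm `|K| ‖w‖` (`norm_sq_tangential`).
-/

noncomputable section

namespace LensPTS

/-! ### Bijections with invertible differentials, curves, and quotients by deck transformations -/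

section General
variable {E : Type*} [NormedAddCommGroup E] [NormedSpace ℝ E] {H : Type*} [TopologicalSpace H]
  {I : ModelWithCorners ℝ E H} {M : Type*} [TopologicalSpace M] [ChartedSpace H M]
  {E' : Type*} [NormedAddCommGroup E'] [NormedSpace ℝ E'] {H' : Type*} [TopologicalSpace H']
  {J : ModelWithCorners ℝ E' H'} {N : Type*} [TopologicalSpace N] [ChartedSpace H' N]

/-- The inverse function theorem for a smooth bijection between manifolds without boundary. -/
theorem contMDiffAt_equiv_symm [IsManifold I ∞ M] [IsManifold J ∞ N] [I.Boundaryless]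
    [J.Boundaryless] [FiniteDimensional ℝ E] [FiniteDimensional ℝ E'] (e : M ≃ N)
    (he : ContMDiff I J ∞ e) (x : M) (hbij : Function.Bijective (mfderiv I J e x)) :
    ContMDiffAt J I ∞ e.symm (e x) := by
  have : CompleteSpace E := FiniteDimensional.complete ℝ E
  set x' := extChartAt I x x
  set ψ := writtenInExtChartAt I J x e
  have hψ : ContDiffAt ℝ ∞ ψ x' := by
    have := (contMDiffAt_iff.1 (he x)).2
    rwa [I.range_eq_univ, contDiffWithinAt_univ] at this
  have hd : mfderiv I J e x = fderiv ℝ ψ x' := by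
    rw [((he x).mdifferentiableAt (by simp)).mfderiv, I.range_eq_univ, fderivWithin_univ]
  have hb' : Function.Bijective (fderiv ℝ ψ x') := hd ▸ hbij
  set L : E ≃L[ℝ] E' := (LinearEquiv.ofBijective (fderiv ℝ ψ x' : E →ₗ[ℝ] E')
    hb').toContinuousLinearEquiv
  have hL : HasFDerivAt ψ (L : E →L[ℝ] E') x' := by
    have := (hψ.differentiableAt (by simp)).hasFDerivAt
    have hLc : (L : E →L[ℝ] E') = fderiv ℝ ψ x' := by ext v; rfl
    rwa [hLc]
  have hne : (∞ : WithTop ℕ∞) ≠ 0 := by simp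
  have hinv : ContDiffAt ℝ ∞ (hψ.localInverse hL hne) (ψ x') := hψ.to_localInverse hL hne
  have hψx : ψ x' = extChartAt J (e x) (e x) := by simp [ψ, x', writtenInExtChartAt]
  have hstrict := hψ.hasStrictFDerivAt' hL hne
  have hval : hψ.localInverse hL hne (ψ x') = x' := hψ.localInverse_apply_image hL hne
  have hright : ∀ᶠ y in 𝓝 (ψ x'), ψ (hψ.localInverse hL hne y) = y :=
    hstrict.eventually_right_inverse
  rw [hψx] at hinv hval hright
  have hc : ContinuousAt (fun y => hψ.localInverse hL hne (extChartAt J (e x) y)) (e x) :=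
    ContinuousAt.comp (f := extChartAt J (e x)) hinv.continuousAt (continuousAt_extChartAt _)
  have hx' : (extChartAt I x).symm x' = x := extChartAt_to_inv x
  have hsm : ContMDiffAt J I ∞ (fun y => (extChartAt I x).symm
      (hψ.localInverse hL hne (extChartAt J (e x) y))) (e x) := by
    have h1 : ContMDiffAt 𝓘(ℝ, E) I ∞ (extChartAt I x).symm x' :=
      (contMDiffOn_extChartAt_symm x).contMDiffAt (extChartAt_target_mem_nhds x)
    refine ContMDiffAt.comp_of_eq h1
      (hinv.contMDiffAt.comp (e x) contMDiffAt_extChartAt) hval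
  have hc2 : ContinuousAt (fun y => e ((extChartAt I x).symm
      (hψ.localInverse hL hne (extChartAt J (e x) y)))) (e x) := by
    refine ContinuousAt.comp (g := e) ?_ hsm.continuousAt
    exact he.continuous.continuousAt
  refine hsm.congr_of_eventuallyEq ?_
  have e1 : ∀ᶠ y in 𝓝 (e x), ψ (hψ.localInverse hL hne (extChartAt J (e x) y)) =
      extChartAt J (e x) y := (continuousAt_extChartAt (e x)).eventually hright
  have e2 : ∀ᶠ y in 𝓝 (e x), e ((extChartAt I x).symm
      (hψ.localInverse hL hne (extChartAt J (e x) y))) ∈ (extChartAt J (e x)).source := by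
    refine hc2 ?_
    simp only [hval, hx']
    exact extChartAt_source_mem_nhds (e x)
  filter_upwards [e1, e2, extChartAt_source_mem_nhds (I := J) (e x)] with y h1 h2 h3
  rw [Equiv.symm_apply_eq]
  refine ((extChartAt J (e x)).injOn h2 h3 ?_).symm
  exact h1

/-- A smooth bijection with invertible differentials is a diffeomorphism (inverse function
theorem). -/
def diffeomorphOfEquiv [IsManifold I ∞ M] [IsManifold J ∞ N] [I.Boundaryless]
    [J.Boundaryless] [FiniteDimensional ℝ E] [FiniteDimensional ℝ E'] (e : M ≃ N)
    (he : ContMDiff I J ∞ e) (hbij : ∀ x, Function.Bijective (mfderiv I J e x)) :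
    Diffeomorph I J M N ∞ where
  toEquiv := e
  contMDiff_toFun := he
  contMDiff_invFun y := by
    have := contMDiffAt_equiv_symm e he (e.symm y) (hbij _)
    rwa [e.apply_symm_apply] at this

/-- In charts a `C¹` map is locally Lipschitz, so it preserves Lipschitz curves. -/
theorem IsLipschitzCurve.comp [IsManifold I 1 M] [IsManifold J 1 N] [I.Boundaryless]
    {f : M → N} (hf : ContMDiff I J 1 f) {T : ℝ} {γ : ℝ → M} (hγ : IsLipschitzCurve I T γ) :
    IsLipschitzCurve J T (fun t => f (γ t)) := by
  intro t ht
  obtain ⟨hc, K, s, hs, hK⟩ := hγ t ht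
  refine ⟨hf.continuous.continuousAt.comp_continuousWithinAt hc, ?_⟩
  have hψ : ContDiffAt ℝ 1 (writtenInExtChartAt I J (γ t) f) (extChartAt I (γ t) (γ t)) := by
    have := (contMDiffAt_iff.1 (hf (γ t))).2
    rwa [I.range_eq_univ, contDiffWithinAt_univ] at this
  obtain ⟨K', u, hu, hK'⟩ := hψ.exists_lipschitzOnWith
  have hext : ContinuousWithinAt (extChartAt I (γ t) ∘ γ) (Icc 0 T) t :=
    (continuousAt_extChartAt (γ t)).comp_continuousWithinAt hc
  have hu' := hext hu
  have hsrc := hc (extChartAt_source_mem_nhds (I := I) (γ t))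
  refine ⟨K' * K, s ∩ ((extChartAt I (γ t) ∘ γ) ⁻¹' u ∩ γ ⁻¹' (extChartAt I (γ t)).source),
    Filter.inter_mem hs (Filter.inter_mem hu' hsrc), ?_⟩
  have hcomp := hK'.comp (hK.mono (inter_subset_left (t := (extChartAt I (γ t) ∘ γ) ⁻¹' u ∩
    γ ⁻¹' (extChartAt I (γ t)).source))) fun r hr => hr.2.1
  intro r hr r' hr'
  have h := hcomp hr hr'
  simp only [Function.comp, writtenInExtChartAt, (extChartAt I (γ t)).left_inv hr.2.2,
    (extChartAt I (γ t)).left_inv hr'.2.2] at h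
  exact h

theorem isLipschitzCurve_of_contMDiffOn [IsManifold I 1 M] {T : ℝ} {γ : ℝ → M}
    (hγ : ContMDiffOn 𝓘(ℝ, ℝ) I 1 γ (Icc 0 T)) : IsLipschitzCurve I T γ := by
  intro t ht
  refine ⟨(hγ t ht).continuousWithinAt, ?_⟩
  have h := (contMDiffWithinAt_iff_target.1 (hγ t ht)).2
  exact (contMDiffWithinAt_iff_contDiffWithinAt.1 h).exists_lipschitzOnWith (convex_Icc 0 T)

theorem uniqueMDiffWithinAt_Icc {T : ℝ} (hT : 0 < T) {t : ℝ} (ht : t ∈ Icc 0 T) :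
    UniqueMDiffWithinAt 𝓘(ℝ, ℝ) (Icc 0 T) t :=
  (uniqueDiffOn_Icc hT t ht).uniqueMDiffWithinAt

theorem velocity_comp {f : M → N} {T : ℝ} (hT : 0 < T) {γ : ℝ → M} {t : ℝ} (ht : t ∈ Icc 0 T)
    (hf : MDifferentiableAt I J f (γ t))
    (hγ : MDifferentiableWithinAt 𝓘(ℝ, ℝ) I γ (Icc 0 T) t) :
    velocity J T (fun t => f (γ t)) t = mfderiv I J f (γ t) (velocity I T γ t) := by
  have := mfderiv_comp_mfderivWithin t hf hγ (uniqueMDiffWithinAt_Icc hT ht)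
  exact congrArg (fun L => L (1 : ℝ)) this

/-- For a diffeomorphism the chain rule holds at every time: where the curve is not differentiable,
neither is its image, and both velocities are zero by convention. -/
theorem velocity_diffeomorph {f : Diffeomorph I J M N ∞} {T : ℝ} (hT : 0 < T) {γ : ℝ → M} {t : ℝ}
    (ht : t ∈ Icc 0 T) :
    velocity J T (fun t => f (γ t)) t = mfderiv I J f (γ t) (velocity I T γ t) := by
  by_cases h : MDifferentiableWithinAt 𝓘(ℝ, ℝ) I γ (Icc 0 T) t
  · exact velocity_comp hT ht (f.contMDiff.mdifferentiableAt (by simp)) h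
  · have h' : ¬ MDifferentiableWithinAt 𝓘(ℝ, ℝ) J (fun t => f (γ t)) (Icc 0 T) t := by
      intro h'
      apply h
      have := (f.symm.contMDiff.mdifferentiableAt (x := f (γ t))
        (by simp)).comp_mdifferentiableWithinAt t h'
      refine this.congr (fun s _ => ?_) ?_ <;> simp
    have h1 : velocity J T (fun t => f (γ t)) t = 0 := by
      simp only [velocity]
      rw [mfderivWithin_zero_of_not_mdifferentiableWithinAt h']; rfl
    have h2 : velocity I T γ t = 0 := by
      simp only [velocity]
      rw [mfderivWithin_zero_of_not_mdifferentiableWithinAt h]; rfl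
    rw [h1, h2, map_zero]

end General

section Quotient
variable {H : Type*} [TopologicalSpace H] {E : Type*} [NormedAddCommGroup E] [NormedSpace ℝ E]
  {I : ModelWithCorners ℝ E H} {M N : Type*} [TopologicalSpace M] [TopologicalSpace N]
  [ChartedSpace H M] [IsManifold I ∞ M]

/-- For the smooth structure pushed forward by `f`, the map `f` has smooth local sections. -/
theorem exists_section_of_deck {f : M → N} (hf : IsLocalHomeomorph f)
    (hs : Function.Surjective f)
    (hdeck : ∀ x y, f x = f y → ∃ φ : M → M, φ x = y ∧ ContMDiffAt I I ∞ φ x ∧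
      ∀ z, f (φ z) = f z) (y : N) :
    letI := hf.chartedSpace (H := H) hs
    ∃ σ : N → M, ContMDiffAt I I ∞ σ y ∧ ∀ᶠ z in 𝓝 y, f (σ z) = z := by
  let := hf.chartedSpace (H := H) hs
  have : IsManifold I ∞ N := isManifold_of_deck hf hs hdeck
  set b := hs.hasRightInverse.choose y
  have hb : f b = y := hs.hasRightInverse.choose_spec y
  set lb := hf.localInverseAt b
  have hy : y ∈ lb.source := by
    have := hf.apply_self_mem_localInverseAt_source (x := b)
    rwa [hb] at this
  have hlb : lb y = b := by
    rw [← hb]; exact hf.localInverseAt_apply_self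
  refine ⟨lb, ?_, ?_⟩
  · rw [contMDiffAt_iff_target]
    refine ⟨lb.continuousAt hy, ?_⟩
    rw [hlb]
    exact contMDiffAt_extChartAt (I := I) (x := y)
  · filter_upwards [lb.open_source.mem_nhds hy] with z hz
    exact hf.apply_localInverseAt_of_mem hz

/-- For the smooth structure pushed forward by `f`, the map `f` is smooth: up to a deck
transformation it is the local homeomorphism that defines the chart. -/
theorem contMDiff_of_deck {f : M → N} (hf : IsLocalHomeomorph f)
    (hs : Function.Surjective f)
    (hdeck : ∀ x y, f x = f y → ∃ φ : M → M, φ x = y ∧ ContMDiffAt I I ∞ φ x ∧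
      ∀ z, f (φ z) = f z) :
    letI := hf.chartedSpace (H := H) hs
    ContMDiff I I ∞ f := by
  let := hf.chartedSpace (H := H) hs
  have : IsManifold I ∞ N := isManifold_of_deck hf hs hdeck
  intro x
  set b := hs.hasRightInverse.choose (f x)
  have hb : f b = f x := hs.hasRightInverse.choose_spec (f x)
  set lb := hf.localInverseAt b
  obtain ⟨φ, hφx, hφ, hφf⟩ := hdeck x b hb.symm
  rw [contMDiffAt_iff_target]
  refine ⟨hf.continuous.continuousAt, ?_⟩
  have h1 : ContMDiffAt I 𝓘(ℝ, E) ∞ (extChartAt I b ∘ φ) x :=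
    ContMDiffAt.comp_of_eq (g := extChartAt I b) contMDiffAt_extChartAt hφ hφx
  refine h1.congr_of_eventuallyEq ?_
  have h2 : ∀ᶠ z in 𝓝 x, φ z ∈ lb.target := by
    refine hφ.continuousAt (lb.open_target.mem_nhds ?_)
    rw [hφx]
    exact hf.self_mem_localInverseAt_target
  filter_upwards [h2] with z hz
  have hlb : ∀ z, lb.symm z = f z := fun z => congrFun (hf.localInverseAt_symm b) z
  have : lb (f z) = φ z := by
    rw [← hφf, ← hlb, lb.right_inv hz]
  change I (chartAt H b (lb (f z))) = I (chartAt H b (φ z))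
  rw [this]

end Quotient

/-- Points of a fibre of `lensProj` are exchanged by a right translation. -/
theorem lensProj_deck (x y : SU2) (h : lensProj x = lensProj y) :
    ∃ φ : SU2 → SU2, φ x = y ∧ ContMDiffAt (𝓡 3) (𝓡 3) ∞ φ x ∧
      ∀ z, lensProj (φ z) = lensProj z := by
  have hm : x⁻¹ * y ∈ lensSubgroup := QuotientGroup.eq.1 h
  exact ⟨fun g => g * (x⁻¹ * y), by simp, (contMDiff_mul_right _).contMDiffAt,
    fun z => QuotientGroup.mk_mul_of_mem z hm⟩

theorem contMDiff_lensProj : ContMDiff (𝓡 3) (𝓡 3) ∞ lensProj :=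
  contMDiff_of_deck isLocalHomeomorph_lensProj QuotientGroup.mk_surjective lensProj_deck

theorem exists_section_lensProj (q : L41) :
    ∃ σ : L41 → SU2, ContMDiffAt (𝓡 3) (𝓡 3) ∞ σ q ∧ ∀ᶠ z in 𝓝 q, lensProj (σ z) = z :=
  exists_section_of_deck isLocalHomeomorph_lensProj QuotientGroup.mk_surjective lensProj_deck q

/-! ### The bundle of directions of the sphere, seen in `ℝ³` -/

theorem contMDiff_coe_S2 : ContMDiff (𝓡 2) 𝓘(ℝ, E3) ∞ (fun x : S2 => (x : E3)) :=
  have : Fact (Module.finrank ℝ E3 = 2 + 1) := ⟨finrank_euclideanSpace_fin⟩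
  contMDiff_coe_sphere

theorem toAmbient_injective (x : S2) : Function.Injective (toAmbient x) :=
  have : Fact (Module.finrank ℝ E3 = 2 + 1) := ⟨finrank_euclideanSpace_fin⟩
  injective_mvfderiv_subtypeVal_sphere x

theorem range_toAmbient (x : S2) :
    LinearMap.range (toAmbient x : TangentSpace (𝓡 2) x →ₗ[ℝ] E3) =
      (Submodule.span ℝ {(x : E3)})ᗮ :=
  have : Fact (Module.finrank ℝ E3 = 2 + 1) := ⟨finrank_euclideanSpace_fin⟩
  range_mvfderiv_subtypeVal x

/-- The inclusion of `S²` in `ℝ³`, read in the chart at `x₀`. -/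
def chartParam (x₀ : S2) (u : E2) : E3 := (extChartAt (𝓡 2) x₀).symm u

theorem contDiffAt_chartParam (x₀ : S2) {u : E2} (hu : u ∈ (extChartAt (𝓡 2) x₀).target) :
    ContDiffAt ℝ ∞ (chartParam x₀) u := by
  rw [← contMDiffAt_iff_contDiffAt]
  refine contMDiff_coe_S2.contMDiffAt.comp u ?_
  exact (contMDiffOn_extChartAt_symm x₀).contMDiffAt
    ((isOpen_extChartAt_target x₀).mem_nhds hu)

/-- The chart of the sphere at `x₀` extends smoothly to a neighbourhood of the sphere minus the
antipode of `x₀`. -/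
theorem exists_chart_extension (x₀ : S2) : ∃ Ψ : E3 → E2,
    (∀ z ∈ (extChartAt (𝓡 2) x₀).source, ContDiffAt ℝ ∞ Ψ z) ∧
    ∀ z : S2, Ψ z = extChartAt (𝓡 2) x₀ z := by
  have : Fact (Module.finrank ℝ E3 = 2 + 1) := ⟨finrank_euclideanSpace_fin⟩
  let U := (OrthonormalBasis.fromOrthogonalSpanSingleton (𝕜 := ℝ) 2
    (ne_zero_of_mem_unit_sphere (-x₀))).repr
  refine ⟨fun z => U (stereoToFun ((-x₀ : S2) : E3) z), fun z hz => ?_, fun z => rfl⟩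
  have h1 : (z : E3) ∈ {x : E3 | innerSL ℝ ((-x₀ : S2) : E3) x ≠ (1 : ℝ)} := by
    have hz' : z ≠ -x₀ := by
      have h : z ∈ (chartAt E2 x₀).source := by simpa using hz
      have h' : z ∈ (stereographic' 2 (-x₀)).source := h
      rw [stereographic'_source] at h'
      exact h'
    intro h
    apply hz'
    rw [sphere_ext_iff, real_inner_comm]
    exact h
  have h2 : IsOpen {x : E3 | innerSL ℝ ((-x₀ : S2) : E3) x ≠ (1 : ℝ)} :=
    isOpen_ne.preimage (innerSL ℝ ((-x₀ : S2) : E3)).continuous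
  exact U.contDiff.contDiffAt.comp _ ((contDiffOn_stereoToFun (n := ∞)).contDiffAt (h2.mem_nhds h1))

/-- A tangent vector at `z` with coordinates `v` in the chart at `x₀`, seen in `ℝ³`. -/
theorem toAmbient_coordChange (x₀ z : S2) (hz : z ∈ (extChartAt (𝓡 2) x₀).source) (v : E2) :
    toAmbient z (tangentCoordChange (𝓡 2) x₀ z z v) =
      fderiv ℝ (chartParam x₀) (extChartAt (𝓡 2) x₀ z) v := by
  have hzz := mem_extChartAt_source (I := 𝓡 2) z
  have h1 : toAmbient z = fderiv ℝ (chartParam z) (extChartAt (𝓡 2) z z) := by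
    rw [toAmbient, ((contMDiff_coe_S2 z).mdifferentiableAt (by simp)).mvfderiv,
      ModelWithCorners.range_eq_univ, fderivWithin_univ]
    rfl
  have h2 : tangentCoordChange (𝓡 2) x₀ z z =
      fderiv ℝ (extChartAt (𝓡 2) z ∘ (extChartAt (𝓡 2) x₀).symm) (extChartAt (𝓡 2) x₀ z) := by
    rw [tangentCoordChange_def, ModelWithCorners.range_eq_univ, fderivWithin_univ]
  have hinv : (extChartAt (𝓡 2) x₀).symm (extChartAt (𝓡 2) x₀ z) = z :=
    (extChartAt (𝓡 2) x₀).left_inv hz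
  have ht := (extChartAt (𝓡 2) x₀).map_source hz
  have hc : ContMDiffAt 𝓘(ℝ, E2) (𝓡 2) ∞ (extChartAt (𝓡 2) x₀).symm (extChartAt (𝓡 2) x₀ z) :=
    (contMDiffOn_extChartAt_symm x₀).contMDiffAt ((isOpen_extChartAt_target x₀).mem_nhds ht)
  have h3 : chartParam x₀ =ᶠ[𝓝 (extChartAt (𝓡 2) x₀ z)]
      chartParam z ∘ (extChartAt (𝓡 2) z ∘ (extChartAt (𝓡 2) x₀).symm) := by
    have : ∀ᶠ u in 𝓝 (extChartAt (𝓡 2) x₀ z),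
        (extChartAt (𝓡 2) x₀).symm u ∈ (extChartAt (𝓡 2) z).source := by
      refine hc.continuousAt ?_
      rw [hinv]
      exact extChartAt_source_mem_nhds z
    filter_upwards [this] with u hu
    simp only [chartParam, Function.comp]
    rw [(extChartAt (𝓡 2) z).left_inv hu]
  have hd1 : DifferentiableAt ℝ (extChartAt (𝓡 2) z ∘ (extChartAt (𝓡 2) x₀).symm)
      (extChartAt (𝓡 2) x₀ z) := by
    have : ContMDiffAt 𝓘(ℝ, E2) 𝓘(ℝ, E2) ∞ (extChartAt (𝓡 2) z ∘ (extChartAt (𝓡 2) x₀).symm)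
        (extChartAt (𝓡 2) x₀ z) :=
      ContMDiffAt.comp_of_eq (g := extChartAt (𝓡 2) z) contMDiffAt_extChartAt hc hinv
    exact (contMDiffAt_iff_contDiffAt.1 this).differentiableAt (by simp)
  have hval : (extChartAt (𝓡 2) z ∘ (extChartAt (𝓡 2) x₀).symm) (extChartAt (𝓡 2) x₀ z) =
      extChartAt (𝓡 2) z z := by simp only [Function.comp, hinv]
  rw [h3.fderiv_eq, fderiv_comp _ _ hd1, hval, ← h1, h2]
  · rfl
  · rw [hval]
    exact (contDiffAt_chartParam z (mem_extChartAt_target z)).differentiableAt (by simp)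

theorem submodule_direction {v : E2} (hv : v ≠ 0) :
    (direction v).submodule = Submodule.span ℝ {v} := by
  rw [direction, dif_pos hv, Projectivization.submodule_mk]

theorem map_direction (z : S2) {v : E2} (hv : v ≠ 0) :
    Submodule.map (toAmbient z : TangentSpace (𝓡 2) z →ₗ[ℝ] E3) (direction v).submodule =
      Submodule.span ℝ {toAmbient z v} := by
  have h : (direction v).submodule = Submodule.span ℝ {v} := submodule_direction hv
  refine (congrArg (Submodule.map (toAmbient z : TangentSpace (𝓡 2) z →ₗ[ℝ] E3)) h).trans ?_
  refine (Submodule.map_span (toAmbient z : TangentSpace (𝓡 2) z →ₗ[ℝ] E3) {v}).trans ?_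
  exact congrArg (Submodule.span ℝ) image_singleton

theorem line_eq_span_rep (q : PTS2) :
    line q = Submodule.span ℝ {toAmbient q.base q.dir.rep} := by
  have h : q.dir.submodule = Submodule.span ℝ {q.dir.rep} := by
    conv_lhs => rw [← q.dir.mk_rep]
    rw [Projectivization.submodule_mk]
  rw [line, h, Submodule.map_span, image_singleton]
  rfl

theorem toAmbient_rep_ne_zero (q : PTS2) : toAmbient q.base q.dir.rep ≠ 0 := fun h =>
  q.dir.rep_nonzero (toAmbient_injective q.base (h.trans (map_zero _).symm))

theorem exists_smul_rep {q : PTS2} {w : E3} (hw : w ∈ line q) (hw0 : w ≠ 0) :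
    ∃ r : ℝ, r ≠ 0 ∧ w = r • toAmbient q.base q.dir.rep := by
  rw [line_eq_span_rep] at hw
  obtain ⟨r, hr⟩ := Submodule.mem_span_singleton.1 hw
  exact ⟨r, fun h => hw0 (by rw [← hr, h, zero_smul]), hr.symm⟩

theorem line_eq_span {q : PTS2} {w : E3} (hw : w ∈ line q) (hw0 : w ≠ 0) :
    line q = Submodule.span ℝ {w} := by
  obtain ⟨r, hr, rfl⟩ := exists_smul_rep hw hw0
  rw [line_eq_span_rep, Submodule.span_singleton_smul_eq (IsUnit.mk0 r hr)]

theorem ProjTangent.ext_line {q q' : PTS2} (hb : q.base = q'.base) (hl : line q = line q') :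
    q = q' := by
  obtain ⟨x, l⟩ := q
  obtain ⟨x', l'⟩ := q'
  obtain rfl : x = x' := hb
  congr 1
  apply Projectivization.submodule_injective
  exact Submodule.map_injective_of_injective (toAmbient_injective x) hl

/-- Every line of `ℝ³` orthogonal to `x` is a direction of the sphere at `x`. -/
theorem exists_line {x : S2} {w : E3} (hw : w ≠ 0) (hx : ⟪(x : E3), w⟫ = 0) :
    ∃ l : ℙ ℝ (TangentSpace (𝓡 2) x), line ⟨x, l⟩ = Submodule.span ℝ {w} := by
  have : w ∈ LinearMap.range (toAmbient x : TangentSpace (𝓡 2) x →ₗ[ℝ] E3) := by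
    rw [range_toAmbient, Submodule.mem_orthogonal_singleton_iff_inner_right]
    exact hx
  obtain ⟨v, hv⟩ := this
  have hv0 : v ≠ 0 := by rintro rfl; exact hw (by rw [← hv, map_zero])
  refine ⟨Projectivization.mk ℝ v hv0, ?_⟩
  rw [line, Projectivization.submodule_mk, Submodule.map_span, image_singleton]
  rw [hv]

theorem inner_base_of_mem_line {q : PTS2} {w : E3} (hw : w ∈ line q) : ⟪(q.base : E3), w⟫ = 0 := by
  obtain ⟨v, -, rfl⟩ := hw
  rw [← Submodule.mem_orthogonal_singleton_iff_inner_right, ← range_toAmbient]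
  exact ⟨v, rfl⟩

/-- A vector of `ℝ³` spanning the direction with coordinates `y` in a lifted chart. -/
def chartVec (x₀ : S2) (j : Fin 2) (y : E2 × ℝ) : E3 :=
  fderiv ℝ (chartParam x₀) y.1 (slopeVec j y.2)

theorem contDiff_slopeVec (j : Fin 2) : ContDiff ℝ ∞ (slopeVec j) := by
  rw [contDiff_euclidean]
  intro i
  simp only [slopeVec]
  split_ifs
  · exact contDiff_const
  · exact contDiff_id

theorem contDiffAt_chartVec (x₀ : S2) (j : Fin 2) {y : E2 × ℝ}
    (hy : y.1 ∈ (extChartAt (𝓡 2) x₀).target) : ContDiffAt ℝ ∞ (chartVec x₀ j) y := by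
  have h1 : ContDiffAt ℝ ∞ (fderiv ℝ (chartParam x₀)) y.1 :=
    (contDiffAt_chartParam x₀ hy).fderiv_right (by simp)
  exact (h1.comp y contDiffAt_fst).clm_apply
    ((contDiff_slopeVec j).contDiffAt.comp y contDiffAt_snd)

theorem chartVec_spec (x₀ : S2) (j : Fin 2) {y : E2 × ℝ}
    (hy : y.1 ∈ (extChartAt (𝓡 2) x₀).target) :
    chartVec x₀ j y ≠ 0 ∧ line (projChartInv x₀ j y) = Submodule.span ℝ {chartVec x₀ j y} := by
  have h0 := (extChartAt (𝓡 2) x₀).map_target hy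
  set z := (extChartAt (𝓡 2) x₀).symm y.1 with hz
  have hzz := mem_extChartAt_source (I := 𝓡 2) z
  have hv := coordChange_ne_zero h0 hzz (slopeVec_ne_zero j y.2)
  have h := toAmbient_coordChange x₀ z h0 (slopeVec j y.2)
  rw [hz, (extChartAt (𝓡 2) x₀).right_inv hy, ← hz] at h
  constructor
  · rw [chartVec, ← h]
    intro h'
    exact hv (toAmbient_injective z (h'.trans (map_zero _).symm))
  · have hl : line (projChartInv x₀ j y) = ((direction (tangentCoordChange (𝓡 2) x₀ z z
        (slopeVec j y.2))).submodule).map (toAmbient z : TangentSpace (𝓡 2) z →ₗ[ℝ] E3) := rfl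
    rw [hl, map_direction z hv]
    exact congrArg (fun w => Submodule.span ℝ {w}) h

/-- The coordinates in the chart at `x₀` of a vector of the direction `q`. -/
theorem coordRep_eq (x₀ : S2) {Ψ : E3 → E2} (q : PTS2)
    (hq : q.base ∈ (extChartAt (𝓡 2) x₀).source)
    (hΨ : ContDiffAt ℝ ∞ Ψ (q.base : E3)) (hΨe : ∀ z : S2, Ψ z = extChartAt (𝓡 2) x₀ z) :
    coordRep x₀ q = fderiv ℝ Ψ (q.base : E3) (toAmbient q.base q.dir.rep) := by
  have hx := mem_extChartAt_source (I := 𝓡 2) q.base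
  have h := toAmbient_coordChange x₀ q.base hq (coordRep x₀ q)
  have h1 : tangentCoordChange (𝓡 2) x₀ q.base q.base (coordRep x₀ q) = q.dir.rep :=
    coordChange_inv hx hq _
  rw [h1] at h
  have ht := (extChartAt (𝓡 2) x₀).map_source hq
  have hp : chartParam x₀ (extChartAt (𝓡 2) x₀ q.base) = q.base := by
    simp only [chartParam, (extChartAt (𝓡 2) x₀).left_inv hq]
  have hid : Ψ ∘ chartParam x₀ =ᶠ[𝓝 (extChartAt (𝓡 2) x₀ q.base)] id := by
    filter_upwards [(isOpen_extChartAt_target x₀).mem_nhds ht] with u hu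
    simp only [Function.comp, chartParam, hΨe, (extChartAt (𝓡 2) x₀).right_inv hu, id]
  have hcomp := fderiv_comp (g := Ψ) (f := chartParam x₀) (extChartAt (𝓡 2) x₀ q.base)
    (by rw [hp]; exact hΨ.differentiableAt (by simp))
    ((contDiffAt_chartParam x₀ ht).differentiableAt (by simp))
  rw [hid.fderiv_eq, fderiv_id, hp] at hcomp
  have := congrArg (fun L : E2 →L[ℝ] E2 => L (coordRep x₀ q)) hcomp
  simp only [ContinuousLinearMap.id_apply, ContinuousLinearMap.comp_apply] at this
  rw [h]
  exact this

/-- The index of the affine coordinate in the preferred chart at `q`. -/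
def chartIndex (q : PTS2) : Fin 2 := (exists_projChart q).choose

theorem extChartAt_PTS2 (q : PTS2) :
    extChartAt 𝓘(ℝ, E2 × ℝ) q = projChart q.base (chartIndex q) := by
  refine PartialEquiv.ext (fun _ => rfl) (fun _ => rfl) ?_
  rw [extChartAt_source]
  rfl

theorem contMDiff_base : ContMDiff 𝓘(ℝ, E2 × ℝ) (𝓡 2) ∞ (ProjTangent.base : PTS2 → S2) := by
  intro q
  have hq := mem_extChartAt_source (I := 𝓘(ℝ, E2 × ℝ)) q
  have h1 : ContMDiffAt 𝓘(ℝ, E2 × ℝ) 𝓘(ℝ, E2 × ℝ) ∞ (extChartAt 𝓘(ℝ, E2 × ℝ) q) q :=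
    contMDiffAt_extChartAt
  have h2 : ContMDiffAt 𝓘(ℝ, E2 × ℝ) 𝓘(ℝ, E2) ∞ (fun r => (extChartAt 𝓘(ℝ, E2 × ℝ) q r).1) q :=
    (contDiff_fst.contMDiff.contMDiffAt).comp q h1
  have hb : (extChartAt 𝓘(ℝ, E2 × ℝ) q q).1 = extChartAt (𝓡 2) q.base q.base := by
    rw [extChartAt_PTS2]; rfl
  have h3 : ContMDiffAt 𝓘(ℝ, E2) (𝓡 2) ∞ (extChartAt (𝓡 2) q.base).symm
      (extChartAt (𝓡 2) q.base q.base) :=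
    (contMDiffOn_extChartAt_symm q.base).contMDiffAt (extChartAt_target_mem_nhds q.base)
  refine (h3.comp_of_eq h2 hb).congr_of_eventuallyEq ?_
  filter_upwards [extChartAt_source_mem_nhds (I := 𝓘(ℝ, E2 × ℝ)) q] with r hr
  rw [extChartAt_PTS2] at hr ⊢
  exact ((extChartAt (𝓡 2) q.base).left_inv hr.1).symm

theorem contMDiff_coe_base :
    ContMDiff 𝓘(ℝ, E2 × ℝ) 𝓘(ℝ, E3) ∞ (fun q : PTS2 => (q.base : E3)) :=
  contMDiff_coe_S2.comp contMDiff_base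

theorem unitToward_of_line {q : PTS2} {w : E3} (h : line q = Submodule.span ℝ {w}) (u : E3) :
    unitToward u q = ‖(⟪w, u⟫ / ‖w‖ ^ 2) • w‖⁻¹ • (⟪w, u⟫ / ‖w‖ ^ 2) • w := by
  have : (line q).starProjection u = (⟪w, u⟫ / ‖w‖ ^ 2) • w := by
    simp only [h]
    rw [Submodule.starProjection_singleton]
    rfl
  rw [unitToward, this]

theorem unitVec_mem_line (q : PTS2) : unitVec q ∈ line q := by
  rw [line_eq_span_rep]
  exact Submodule.smul_mem _ _ (Submodule.mem_span_singleton_self _)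

theorem norm_unitVec (q : PTS2) : ‖unitVec q‖ = 1 := by
  have h := toAmbient_rep_ne_zero q
  rw [unitVec, norm_smul, norm_inv, norm_norm, inv_mul_cancel₀ (norm_ne_zero_iff.2 h)]

theorem unitVec_ne_zero (q : PTS2) : unitVec q ≠ 0 := fun h => by
  have := norm_unitVec q
  rw [h, norm_zero] at this
  exact zero_ne_one this

theorem unitVec_eq {q : PTS2} {w : E3} (hw : w ∈ line q) (hw0 : w ≠ 0) :
    ∃ ε : ℝ, ε ^ 2 = 1 ∧ unitVec q = ε • ‖w‖⁻¹ • w := by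
  obtain ⟨r, hr⟩ := Submodule.mem_span_singleton.1 (line_eq_span hw hw0 ▸ unitVec_mem_line q)
  have hn : ‖w‖ ≠ 0 := norm_ne_zero_iff.2 hw0
  have h1 := norm_unitVec q
  rw [← hr, norm_smul, Real.norm_eq_abs] at h1
  refine ⟨r * ‖w‖, ?_, ?_⟩
  · rw [mul_pow, ← sq_abs r, ← mul_pow, h1, one_pow]
  · rw [smul_smul, mul_assoc, mul_inv_cancel₀ hn, mul_one, hr]

/-- Along a family of directions spanned by a continuous family of vectors `w`, the unit vector on
the side of the initial one is locally `± w / ‖w‖`, with a constant sign. -/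
theorem exists_unitToward_eq {N : Type*} [TopologicalSpace N] {φ : N → PTS2} {w : N → E3}
    {s : Set N} {n₀ : N} (hn₀ : n₀ ∈ s) (hc : ContinuousWithinAt w s n₀)
    (hw : ∀ m ∈ s, w m ∈ line (φ m)) (hw0 : ∀ m ∈ s, w m ≠ 0) :
    ∃ ε : ℝ, ε ^ 2 = 1 ∧ ∀ᶠ m in 𝓝[s] n₀,
      unitToward (unitVec (φ n₀)) (φ m) = ε • ‖w m‖⁻¹ • w m := by
  obtain ⟨ε, hε, hu⟩ := unitVec_eq (hw _ hn₀) (hw0 _ hn₀)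
  refine ⟨ε, hε, ?_⟩
  have hn : 0 < ‖w n₀‖ := norm_pos_iff.2 (hw0 _ hn₀)
  have hpos : 0 < ⟪w n₀, ‖w n₀‖⁻¹ • w n₀⟫ := by
    rw [inner_smul_right, real_inner_self_eq_norm_sq]; positivity
  have hcont : ContinuousWithinAt (fun m => ⟪w m, ‖w n₀‖⁻¹ • w n₀⟫) s n₀ :=
    hc.inner continuousWithinAt_const
  filter_upwards [hcont (lt_mem_nhds hpos), self_mem_nhdsWithin] with m hm hms
  change 0 < ⟪w m, ‖w n₀‖⁻¹ • w n₀⟫ at hm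
  have hwm : 0 < ‖w m‖ := norm_pos_iff.2 (hw0 _ hms)
  rw [unitToward_of_line (line_eq_span (hw _ hms) (hw0 _ hms)), hu, inner_smul_right]
  generalize ⟪w m, ‖w n₀‖⁻¹ • w n₀⟫ = c at hm
  have hε1 : |ε| = 1 := by
    rw [← sq_abs] at hε
    exact (pow_eq_one_iff_of_nonneg (abs_nonneg ε) two_ne_zero).1 hε
  rw [norm_smul, Real.norm_eq_abs, abs_div, abs_mul, hε1, abs_of_pos hm,
    abs_of_pos (by positivity : 0 < ‖w m‖ ^ 2),
    smul_smul, smul_smul]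
  congr 1
  field_simp

/-- In a lifted chart the directions are spanned by the smooth field `chartVec`. -/
theorem mdifferentiableAt_unitToward (q : PTS2) :
    MDifferentiableAt 𝓘(ℝ, E2 × ℝ) 𝓘(ℝ, E3) (unitToward (unitVec q)) q := by
  set e := extChartAt 𝓘(ℝ, E2 × ℝ) q with he
  set w : PTS2 → E3 := fun r => chartVec q.base (chartIndex q) (e r) with hw
  have hq := mem_extChartAt_source (I := 𝓘(ℝ, E2 × ℝ)) q
  have hsm : ContMDiffAt 𝓘(ℝ, E2 × ℝ) 𝓘(ℝ, E3) ∞ w q := by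
    have hy : (e q).1 ∈ (extChartAt (𝓡 2) q.base).target := by
      have := e.map_source hq
      rw [he, extChartAt_PTS2] at this
      exact this.1
    exact (contDiffAt_chartVec q.base (chartIndex q) hy).contMDiffAt.comp q contMDiffAt_extChartAt
  have hspec : ∀ r ∈ e.source, w r ∈ line r ∧ w r ≠ 0 := by
    intro r hr
    have h1 : projChartInv q.base (chartIndex q) (e r) = r := by
      have := e.left_inv hr
      rw [he, extChartAt_PTS2] at this
      rw [he, extChartAt_PTS2]
      exact this
    have hy : (e r).1 ∈ (extChartAt (𝓡 2) q.base).target := by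
      have := e.map_source hr
      rw [he, extChartAt_PTS2] at this
      exact this.1
    obtain ⟨h2, h3⟩ := chartVec_spec q.base (chartIndex q) hy
    rw [h1] at h3
    exact ⟨h3 ▸ Submodule.mem_span_singleton_self _, h2⟩
  obtain ⟨ε, -, hev⟩ := exists_unitToward_eq (φ := id) hq hsm.continuousAt.continuousWithinAt
    (fun r hr => (hspec r hr).1) (fun r hr => (hspec r hr).2)
  rw [(isOpen_extChartAt_source q).nhdsWithin_eq hq] at hev
  have hd : MDifferentiableAt 𝓘(ℝ, E2 × ℝ) 𝓘(ℝ, E3) (fun r => ε • ‖w r‖⁻¹ • w r) q := by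
    have hg : ContDiffAt ℝ ∞ (fun v : E3 => ε • ‖v‖⁻¹ • v) (w q) :=
      contDiffAt_const.fun_smul (((contDiffAt_norm ℝ (hspec q hq).2).inv
        (norm_ne_zero_iff.2 (hspec q hq).2)).fun_smul contDiffAt_id)
    exact (hg.contMDiffAt.comp q hsm).mdifferentiableAt (by simp)
  exact hd.congr_of_eventuallyEq hev

/-- A map to `PTS²` is as smooth as its base point and a vector field spanning its directions: with
`Ψ` a smooth extension of the chart of the sphere, the coordinates of the map in the lifted chart
are `Ψ` of the base point and the slope of the image of the field under the derivative of `Ψ`. -/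
theorem contMDiffWithinAt_PTS2 {E : Type*} [NormedAddCommGroup E] [NormedSpace ℝ E]
    {H : Type*} [TopologicalSpace H] {I : ModelWithCorners ℝ E H} {N : Type*} [TopologicalSpace N]
    [ChartedSpace H N] {φ : N → PTS2} {w : N → E3} {s : Set N} {n₀ : N} {n : WithTop ℕ∞}
    (hn : n ≤ ∞) (hn₀ : n₀ ∈ s)
    (hb : ContMDiffWithinAt I 𝓘(ℝ, E3) n (fun m => ((φ m).base : E3)) s n₀)
    (hw : ContMDiffWithinAt I 𝓘(ℝ, E3) n w s n₀)
    (hl : ∀ m ∈ s, w m ∈ line (φ m)) (hw0 : ∀ m ∈ s, w m ≠ 0) :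
    ContMDiffWithinAt I 𝓘(ℝ, E2 × ℝ) n φ s n₀ := by
  set q := φ n₀ with hq
  set j := chartIndex q
  obtain ⟨Ψ, hΨ, hΨe⟩ := exists_chart_extension q.base
  have hqs := mem_extChartAt_source (I := 𝓘(ℝ, E2 × ℝ)) q
  rw [extChartAt_PTS2] at hqs
  have hslope : ∀ m ∈ s, (φ m).base ∈ (extChartAt (𝓡 2) q.base).source → ∃ r : ℝ, r ≠ 0 ∧
      fderiv ℝ Ψ ((φ m).base : E3) (w m) = r • coordRep q.base (φ m) := by
    intro m hm hs
    obtain ⟨r, hr, hwr⟩ := exists_smul_rep (hl m hm) (hw0 m hm)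
    exact ⟨r, hr, by rw [coordRep_eq q.base (φ m) hs (hΨ _ hs) hΨe, hwr, map_smul]⟩
  have hbc : ContinuousWithinAt (fun m => (φ m).base) s n₀ := by
    rw [Topology.IsInducing.subtypeVal.continuousWithinAt_iff]
    exact hb.continuousWithinAt
  have hΨ₀ := hΨ q.base hqs.1
  have hΨ1 : ContMDiffWithinAt I 𝓘(ℝ, E2) n (fun m => Ψ ((φ m).base : E3)) s n₀ :=
    (hΨ₀.of_le hn).contMDiffAt.comp_contMDiffWithinAt n₀ hb
  have hD : ContMDiffWithinAt I 𝓘(ℝ, E3 →L[ℝ] E2) n (fun m => fderiv ℝ Ψ ((φ m).base : E3)) s n₀ :=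
    ((hΨ₀.fderiv_right (m := ∞) (by simp)).of_le hn).contMDiffAt.comp_contMDiffWithinAt n₀ hb
  have hDw : ContMDiffWithinAt I 𝓘(ℝ, E2) n
      (fun m => fderiv ℝ Ψ ((φ m).base : E3) (w m)) s n₀ := hD.clm_apply hw
  obtain ⟨r₀, hr₀, hw₀⟩ := hslope n₀ hn₀ hqs.1
  have hj : fderiv ℝ Ψ ((φ n₀).base : E3) (w n₀) j ≠ 0 := by
    rw [hw₀, PiLp.smul_apply]
    exact smul_ne_zero hr₀ hqs.2
  have hcoord : ∀ i : Fin 2, ContDiff ℝ ∞ (fun v : E2 => v i) := fun i => by fun_prop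
  have hsl : ContMDiffWithinAt I 𝓘(ℝ, ℝ) n
      (fun m => slope j (fderiv ℝ Ψ ((φ m).base : E3) (w m))) s n₀ := by
    have : ContDiffAt ℝ ∞ (slope j) (fderiv ℝ Ψ ((φ n₀).base : E3) (w n₀)) :=
      (hcoord (j + 1)).contDiffAt.div (hcoord j).contDiffAt hj
    exact (this.of_le hn).contMDiffAt.comp_contMDiffWithinAt n₀ hDw
  have hpair : ContMDiffWithinAt I 𝓘(ℝ, E2 × ℝ) n (fun m => (Ψ ((φ m).base : E3),
      slope j (fderiv ℝ Ψ ((φ m).base : E3) (w m)))) s n₀ := hΨ1.prodMk_space hsl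
  have hval : ∀ m ∈ s, (φ m).base ∈ (extChartAt (𝓡 2) q.base).source →
      (Ψ ((φ m).base : E3), slope j (fderiv ℝ Ψ ((φ m).base : E3) (w m))) =
        projChart q.base j (φ m) := by
    intro m hm hs
    obtain ⟨r, hr, h⟩ := hslope m hm hs
    rw [h, slope_smul j hr, hΨe]
    rfl
  have hsymm : ContMDiffAt 𝓘(ℝ, E2 × ℝ) 𝓘(ℝ, E2 × ℝ) n (extChartAt 𝓘(ℝ, E2 × ℝ) q).symm
      (extChartAt 𝓘(ℝ, E2 × ℝ) q q) :=
    ((contMDiffOn_extChartAt_symm q).contMDiffAt (extChartAt_target_mem_nhds q)).of_le hn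
  rw [extChartAt_PTS2] at hsymm
  -- the map is the inverse of the lifted chart composed with its smooth coordinates
  have hcomp := hsymm.comp_contMDiffWithinAt_of_eq hpair (hval n₀ hn₀ hqs.1)
  refine hcomp.congr_of_eventuallyEq_of_mem ?_ hn₀
  have e1 := hbc (extChartAt_source_mem_nhds (I := 𝓡 2) q.base)
  have e2 : ∀ᶠ m in 𝓝[s] n₀, fderiv ℝ Ψ ((φ m).base : E3) (w m) j ≠ 0 :=
    ((hcoord j).continuous.continuousAt.comp_continuousWithinAt
      hDw.continuousWithinAt).eventually_ne hj
  filter_upwards [e1, e2, self_mem_nhdsWithin] with m h1 h2 hm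
  have hsrc : φ m ∈ (projChart q.base j).source := by
    refine ⟨h1, fun h0 => h2 ?_⟩
    obtain ⟨r, hr, h⟩ := hslope m hm h1
    rw [h, PiLp.smul_apply, h0, smul_zero]
  simp only [Function.comp]
  rw [hval m hm h1]
  exact ((projChart q.base j).left_inv hsrc).symm

/-! ### Unit quaternions, frames and spherical coordinates -/

/-- The space of quaternions, in coordinates. -/
abbrev E4 := EuclideanSpace ℝ (Fin 4)

theorem inner_E3 (v w : E3) : ⟪v, w⟫ = v 0 * w 0 + v 1 * w 1 + v 2 * w 2 := by
  simp [PiLp.inner_apply, Fin.sum_univ_three, mul_comm]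

theorem norm_sq_E3 (v : E3) : ‖v‖ ^ 2 = v 0 ^ 2 + v 1 ^ 2 + v 2 ^ 2 := by
  rw [← real_inner_self_eq_norm_sq, inner_E3]; ring

/-- The unit quaternion `x₀ + x₁ i + x₂ j + x₃ k` of an element of `SU(2)`; in terms of it
`p₁ = j / 2` and `p₂ = k / 2`. -/
def quat (g : SU2) : E4 := (sphereHomeoSU2.symm g : E4)

theorem quatMatrix_quat (g : SU2) : quatMatrix (quat g) = g :=
  congrArg Subtype.val (sphereHomeoSU2.apply_symm_apply g)

theorem quat_sq (g : SU2) : quat g 0 ^ 2 + quat g 1 ^ 2 + quat g 2 ^ 2 + quat g 3 ^ 2 = 1 :=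
  sum_sq_sphere (sphereHomeoSU2.symm g)

theorem quatMatrix_injective : Function.Injective quatMatrix := by
  intro x y h
  have h0 := congrFun (congrFun h 0) 0
  have h1 := congrFun (congrFun h 0) 1
  simp only [quatMatrix, Matrix.of_apply, Matrix.cons_val', Matrix.cons_val_zero,
    Matrix.cons_val_one, Matrix.cons_val_fin_one, Complex.mk.injEq] at h0 h1
  ext i
  fin_cases i
  · exact h0.1
  · exact h0.2
  · exact h1.1
  · exact h1.2

theorem quat_injective : Function.Injective quat := fun g h e => by
  apply Subtype.ext
  rw [← quatMatrix_quat g, ← quatMatrix_quat h, e]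

/-- The product of quaternions, in coordinates. -/
def quatMul (x y : E4) : E4 := !₂[
  x 0 * y 0 - x 1 * y 1 - x 2 * y 2 - x 3 * y 3,
  x 0 * y 1 + x 1 * y 0 + x 2 * y 3 - x 3 * y 2,
  x 0 * y 2 - x 1 * y 3 + x 2 * y 0 + x 3 * y 1,
  x 0 * y 3 + x 1 * y 2 - x 2 * y 1 + x 3 * y 0]

theorem quatMatrix_mul (x y : E4) :
    quatMatrix x * quatMatrix y = quatMatrix (quatMul x y) := by
  ext i j
  fin_cases i <;> fin_cases j <;> apply Complex.ext <;>
    simp [quatMatrix, quatMul, Matrix.mul_apply, Fin.sum_univ_two] <;> ring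

theorem quat_mul (g h : SU2) : quat (g * h) = quatMul (quat g) (quat h) := by
  apply quatMatrix_injective
  rw [quatMatrix_quat, ← quatMatrix_mul, quatMatrix_quat, quatMatrix_quat]
  rfl

theorem quat_eq_of_coe {g : SU2} {x : E4} (h : (g : Mat2) = quatMatrix x) : quat g = x :=
  quatMatrix_injective ((quatMatrix_quat g).trans h)

theorem quat_one : quat 1 = !₂[1, 0, 0, 0] := by
  apply quat_eq_of_coe
  ext i j
  fin_cases i <;> fin_cases j <;> apply Complex.ext <;> simp [quatMatrix]

theorem exp_diagonal_I (t : ℝ) : NormedSpace.exp (Matrix.diagonal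
    ![(t : ℂ) * Complex.I, -((t : ℂ) * Complex.I)]) =
    !![Complex.exp ((t : ℂ) * Complex.I), 0; 0, Complex.exp (-((t : ℂ) * Complex.I))] := by
  rw [Matrix.exp_diagonal, Pi.exp_def]
  ext i j; fin_cases i <;> fin_cases j <;> simp [← Complex.exp_eq_exp_ℂ]

/-- `e^{c p₂} = cos (c / 2) + sin (c / 2) k`, by diagonalization of `p₂`. -/
theorem quat_expSU2_p₂ (c : ℝ) :
    quat (expSU2 (c • p₂)) = !₂[Real.cos (c / 2), 0, 0, Real.sin (c / 2)] := by
  obtain ⟨t, rfl⟩ : ∃ t, c = 2 * t := ⟨c / 2, by ring⟩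
  rw [mul_div_cancel_left₀ t two_ne_zero]
  apply quat_eq_of_coe
  have hU : (!![1, 1; 1, -1] : Mat2) * ((1 / 2 : ℂ) • !![1, 1; 1, -1]) = 1 := by
    ext i j; fin_cases i <;> fin_cases j <;> norm_num [Matrix.mul_apply, Fin.sum_univ_two]
  have hinv : (!![1, 1; 1, -1] : Mat2)⁻¹ = (1 / 2 : ℂ) • !![1, 1; 1, -1] :=
    Matrix.inv_eq_right_inv hU
  have hd : ∀ a b : ℂ, Matrix.diagonal ![a, b] = !![a, 0; 0, b] := fun a b => by
    ext i j; fin_cases i <;> fin_cases j <;> simp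
  have h := Matrix.exp_conj (!![1, 1; 1, -1] : Mat2)
    (Matrix.diagonal ![(t : ℂ) * Complex.I, -((t : ℂ) * Complex.I)])
    (IsUnit.of_mul_eq_one _ hU)
  rw [exp_diagonal_I, hinv, hd] at h
  have h1 : (((2 * t) • p₂ : su2) : Mat2) = !![1, 1; 1, -1] *
      !![(t : ℂ) * Complex.I, 0; 0, -((t : ℂ) * Complex.I)] *
      ((1 / 2 : ℂ) • !![1, 1; 1, -1]) := by
    ext i j; fin_cases i <;> fin_cases j <;> simp [p₂] <;> ring
  change NormedSpace.exp (((2 * t) • p₂ : su2) : Mat2) = _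
  rw [h1, h, ← neg_mul, ← Complex.ofReal_neg, Complex.exp_mul_I, Complex.exp_mul_I,
    ← Complex.ofReal_cos, ← Complex.ofReal_sin, ← Complex.ofReal_cos, ← Complex.ofReal_sin,
    Real.cos_neg, Real.sin_neg]
  ext i j; fin_cases i <;> fin_cases j <;> apply Complex.ext <;>
    simp [quatMatrix, -Complex.ofReal_cos, -Complex.ofReal_sin] <;> ring

/-- `e^{a p₁} = cos (a / 2) + sin (a / 2) j`, by diagonalization of `p₁`. -/
theorem quat_expSU2_p₁ (a : ℝ) :
    quat (expSU2 (a • p₁)) = !₂[Real.cos (a / 2), 0, Real.sin (a / 2), 0] := by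
  obtain ⟨t, rfl⟩ : ∃ t, a = 2 * t := ⟨a / 2, by ring⟩
  rw [mul_div_cancel_left₀ t two_ne_zero]
  apply quat_eq_of_coe
  have hU : (!![1, 1; Complex.I, -Complex.I] : Mat2) *
      ((1 / 2 : ℂ) • !![1, -Complex.I; 1, Complex.I]) = 1 := by
    ext i j; fin_cases i <;> fin_cases j <;> apply Complex.ext <;>
      norm_num [Matrix.mul_apply, Fin.sum_univ_two]
  have hinv : (!![1, 1; Complex.I, -Complex.I] : Mat2)⁻¹ =
      (1 / 2 : ℂ) • !![1, -Complex.I; 1, Complex.I] :=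
    Matrix.inv_eq_right_inv hU
  have hd : ∀ a b : ℂ, Matrix.diagonal ![a, b] = !![a, 0; 0, b] := fun a b => by
    ext i j; fin_cases i <;> fin_cases j <;> simp
  have h := Matrix.exp_conj (!![1, 1; Complex.I, -Complex.I] : Mat2)
    (Matrix.diagonal ![(t : ℂ) * Complex.I, -((t : ℂ) * Complex.I)])
    (IsUnit.of_mul_eq_one _ hU)
  rw [exp_diagonal_I, hinv, hd] at h
  have h1 : (((2 * t) • p₁ : su2) : Mat2) = !![1, 1; Complex.I, -Complex.I] *
      !![(t : ℂ) * Complex.I, 0; 0, -((t : ℂ) * Complex.I)] *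
      ((1 / 2 : ℂ) • !![1, -Complex.I; 1, Complex.I]) := by
    ext i j; fin_cases i <;> fin_cases j <;> apply Complex.ext <;> simp [p₁] <;> ring
  change NormedSpace.exp (((2 * t) • p₁ : su2) : Mat2) = _
  rw [h1, h, ← neg_mul, ← Complex.ofReal_neg, Complex.exp_mul_I, Complex.exp_mul_I,
    ← Complex.ofReal_cos, ← Complex.ofReal_sin, ← Complex.ofReal_cos, ← Complex.ofReal_sin,
    Real.cos_neg, Real.sin_neg]
  ext i j; fin_cases i <;> fin_cases j <;> apply Complex.ext <;>
    simp [quatMatrix, -Complex.ofReal_cos, -Complex.ofReal_sin] <;> ring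

/-- The vector `x k x̄` of the imaginary quaternions, for the identification of `a i + b j + c k`
with `(a, -b, c)` in `ℝ³`; the sign makes the Euler angles of `SU(2)` spherical coordinates. -/
def baseVec (x : E4) : E3 := !₂[2 * (x 1 * x 3 + x 0 * x 2), -(2 * (x 2 * x 3 - x 0 * x 1)),
  x 0 ^ 2 - x 1 ^ 2 - x 2 ^ 2 + x 3 ^ 2]

/-- The vector `x i x̄`, with the identification used for `baseVec`. -/
def dirVec (x : E4) : E3 := !₂[x 0 ^ 2 + x 1 ^ 2 - x 2 ^ 2 - x 3 ^ 2,
  -(2 * (x 1 * x 2 + x 0 * x 3)), 2 * (x 1 * x 3 - x 0 * x 2)]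

/-- The vector `x j x̄`, with the identification used for `baseVec`. -/
def conormalVec (x : E4) : E3 := !₂[2 * (x 1 * x 2 - x 0 * x 3),
  -(x 0 ^ 2 - x 1 ^ 2 + x 2 ^ 2 - x 3 ^ 2), 2 * (x 2 * x 3 + x 0 * x 1)]

theorem norm_baseVec {x : E4} (hx : x 0 ^ 2 + x 1 ^ 2 + x 2 ^ 2 + x 3 ^ 2 = 1) :
    ‖baseVec x‖ = 1 := by
  rw [← sq_eq_sq₀ (norm_nonneg _) zero_le_one, norm_sq_E3]
  simp only [baseVec, Matrix.cons_val]
  linear_combination (x 0 ^ 2 + x 1 ^ 2 + x 2 ^ 2 + x 3 ^ 2 + 1) * hx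

theorem norm_dirVec {x : E4} (hx : x 0 ^ 2 + x 1 ^ 2 + x 2 ^ 2 + x 3 ^ 2 = 1) :
    ‖dirVec x‖ = 1 := by
  rw [← sq_eq_sq₀ (norm_nonneg _) zero_le_one, norm_sq_E3]
  simp only [dirVec, Matrix.cons_val]
  linear_combination (x 0 ^ 2 + x 1 ^ 2 + x 2 ^ 2 + x 3 ^ 2 + 1) * hx

theorem norm_conormalVec {x : E4} (hx : x 0 ^ 2 + x 1 ^ 2 + x 2 ^ 2 + x 3 ^ 2 = 1) :
    ‖conormalVec x‖ = 1 := by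
  rw [← sq_eq_sq₀ (norm_nonneg _) zero_le_one, norm_sq_E3]
  simp only [conormalVec, Matrix.cons_val]
  linear_combination (x 0 ^ 2 + x 1 ^ 2 + x 2 ^ 2 + x 3 ^ 2 + 1) * hx

theorem inner_baseVec_dirVec (x : E4) : ⟪baseVec x, dirVec x⟫ = 0 := by
  rw [inner_E3]
  simp only [baseVec, dirVec, Matrix.cons_val]
  ring

theorem inner_baseVec_conormalVec (x : E4) : ⟪baseVec x, conormalVec x⟫ = 0 := by
  rw [inner_E3]
  simp only [baseVec, conormalVec, Matrix.cons_val]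
  ring

theorem inner_dirVec_conormalVec (x : E4) : ⟪dirVec x, conormalVec x⟫ = 0 := by
  rw [inner_E3]
  simp only [dirVec, conormalVec, Matrix.cons_val]
  ring

/-- Conjugation of `k` by `x r` is conjugation of `r k r̄` by `x`: the coefficients are those of
`r k r̄` in the basis `i, j, k`. -/
theorem baseVec_quatMul (x r : E4) : baseVec (quatMul x r) =
    (2 * (r 1 * r 3 + r 0 * r 2)) • dirVec x + (2 * (r 2 * r 3 - r 0 * r 1)) • conormalVec x +
      (r 0 ^ 2 - r 1 ^ 2 - r 2 ^ 2 + r 3 ^ 2) • baseVec x := by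
  ext i
  fin_cases i <;> simp [baseVec, dirVec, conormalVec, quatMul] <;> ring

theorem dirVec_quatMul (x r : E4) : dirVec (quatMul x r) =
    (r 0 ^ 2 + r 1 ^ 2 - r 2 ^ 2 - r 3 ^ 2) • dirVec x +
      (2 * (r 1 * r 2 + r 0 * r 3)) • conormalVec x +
      (2 * (r 1 * r 3 - r 0 * r 2)) • baseVec x := by
  ext i
  fin_cases i <;> simp [baseVec, dirVec, conormalVec, quatMul] <;> ring

theorem quat_eulerSU2 (a b c : ℝ) : quat (eulerSU2 a b c) = !₂[
    Real.cos (a / 2) * Real.cos ((b - c) / 2), Real.sin (a / 2) * Real.sin ((b + c) / 2),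
    Real.sin (a / 2) * Real.cos ((b + c) / 2), -(Real.cos (a / 2) * Real.sin ((b - c) / 2))] := by
  have hneg : -(b • p₂) = (-b) • p₂ := (neg_smul b p₂).symm
  rw [eulerSU2, hneg, quat_mul, quat_mul, quat_expSU2_p₂, quat_expSU2_p₁, quat_expSU2_p₂]
  ext i
  fin_cases i <;>
    simp [quatMul, neg_div, add_div, sub_div, Real.cos_sub, Real.sin_sub, Real.cos_add,
      Real.sin_add] <;> ring

theorem baseVec_eulerSU2 (a b c : ℝ) : baseVec (quat (eulerSU2 a b c)) = sphericalPoint a b := by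
  have ha : a = 2 * (a / 2) := by ring
  have hb : b = (b - c) / 2 + (b + c) / 2 := by ring
  rw [quat_eulerSU2]
  generalize hα : a / 2 = α at *
  generalize hm : (b - c) / 2 = m at *
  generalize hn : (b + c) / 2 = n at *
  rw [ha, hb]
  have h1 := Real.sin_sq_add_cos_sq m
  have h2 := Real.sin_sq_add_cos_sq n
  ext i
  fin_cases i <;> simp [baseVec, sphericalPoint, Real.cos_add, Real.sin_add, Real.sin_two_mul]
  · ring
  · ring
  · rw [Real.cos_two_mul']
    linear_combination Real.cos α ^ 2 * h1 - Real.sin α ^ 2 * h2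

theorem dirVec_eulerSU2 (a b c : ℝ) : dirVec (quat (eulerSU2 a b c)) =
    Real.cos (-c) • frameA a b + Real.sin (-c) • frameB b := by
  have ha : a = 2 * (a / 2) := by ring
  have hb : b = (b - c) / 2 + (b + c) / 2 := by ring
  have hc : -c = (b - c) / 2 - (b + c) / 2 := by ring
  rw [quat_eulerSU2]
  generalize hα : a / 2 = α at *
  generalize hm : (b - c) / 2 = m at *
  generalize hn : (b + c) / 2 = n at *
  rw [hc, ha, hb]
  have h0 := Real.sin_sq_add_cos_sq α
  have h1 := Real.sin_sq_add_cos_sq m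
  have h2 := Real.sin_sq_add_cos_sq n
  ext i
  fin_cases i <;> simp [dirVec, frameA, frameB, Real.cos_add, Real.sin_add, Real.cos_sub,
    Real.sin_sub, Real.sin_two_mul, Real.cos_two_mul']
  · grind
  · grind
  · ring

theorem mem_lensSubgroup_of_quat {g : SU2} (h1 : quat g 1 = 0) (h2 : quat g 2 = 0)
    (h : quat g 0 = 0 ∨ quat g 3 = 0) : g ∈ lensSubgroup := by
  have hs := quat_sq g
  rw [h1, h2] at hs
  set k := expSU2 (Real.pi • p₂) with hk
  have hk1 : quat k = !₂[0, 0, 0, 1] := by rw [hk, quat_expSU2_p₂]; simp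
  have hk2 : quat (k ^ 2) = !₂[-1, 0, 0, 0] := by
    rw [sq, quat_mul, hk1]; ext i; fin_cases i <;> simp [quatMul]
  have hk3 : quat (k ^ 3) = !₂[0, 0, 0, -1] := by
    rw [pow_succ, quat_mul, hk1, hk2]; ext i; fin_cases i <;> simp [quatMul]
  have hmem : ∀ n : ℕ, k ^ n ∈ lensSubgroup := fun n =>
    Subgroup.pow_mem _ (Subgroup.mem_zpowers _) n
  have key : ∀ (n : ℕ) (a b : ℝ), quat (k ^ n) = !₂[a, 0, 0, b] → quat g 0 = a → quat g 3 = b →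
      g ∈ lensSubgroup := by
    intro n a b hq ha hb
    have : g = k ^ n := by
      apply quat_injective
      rw [hq]
      ext i
      fin_cases i <;> simp [ha, hb, h1, h2]
    exact this ▸ hmem n
  rcases h with h | h
  · have hs : quat g 3 * quat g 3 = 1 := by rw [h] at hs; linarith
    rcases mul_self_eq_one_iff.1 hs with h3 | h3
    · exact key 1 0 1 (by rw [pow_one, hk1]) h h3
    · exact key 3 0 (-1) hk3 h h3
  · have hs : quat g 0 * quat g 0 = 1 := by rw [h] at hs; linarith
    rcases mul_self_eq_one_iff.1 hs with h3 | h3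
    · exact key 0 1 0 (by rw [pow_zero, quat_one]) h3 h
    · exact key 2 (-1) 0 hk2 h3 h

/-- The quaternions whose conjugation fixes `k` and preserves the line of `i` are `±1` and `±k`. -/
theorem inv_mul_mem_lensSubgroup {g h : SU2} (hb : baseVec (quat g) = baseVec (quat h)) {r : ℝ}
    (hd : dirVec (quat h) = r • dirVec (quat g)) : g⁻¹ * h ∈ lensSubgroup := by
  set y := quat (g⁻¹ * h) with hy
  have hgy : quat h = quatMul (quat g) y := by rw [hy, ← quat_mul, mul_inv_cancel_left]
  have hs : y 0 ^ 2 + y 1 ^ 2 + y 2 ^ 2 + y 3 ^ 2 = 1 := quat_sq _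
  have hx := quat_sq g
  rw [hgy, baseVec_quatMul] at hb
  rw [hgy, dirVec_quatMul] at hd
  set x := quat g
  have nb := norm_baseVec hx
  have nn := norm_conormalVec hx
  have bd := inner_baseVec_dirVec x
  have bn := inner_baseVec_conormalVec x
  have dn := inner_dirVec_conormalVec x
  have e1 := congrArg (fun v => ⟪baseVec x, v⟫) hb
  have e2 := congrArg (fun v => ⟪conormalVec x, v⟫) hd
  simp only [inner_add_right, inner_smul_right, real_inner_self_eq_norm_sq, nb, nn, bd, bn, dn,
    real_inner_comm (baseVec x), real_inner_comm (dirVec x)] at e1 e2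
  have h12 : y 1 ^ 2 + y 2 ^ 2 = 0 := by linarith
  have h1 : y 1 = 0 := by nlinarith [sq_nonneg (y 1), sq_nonneg (y 2)]
  have h2 : y 2 = 0 := by nlinarith [sq_nonneg (y 1), sq_nonneg (y 2)]
  refine mem_lensSubgroup_of_quat h1 h2 ?_
  rw [h1, h2] at e2
  apply mul_eq_zero.1
  linarith

theorem exists_sphericalPoint (x : S2) :
    ∃ a ∈ Icc 0 Real.pi, ∃ b, (x : E3) = sphericalPoint a b := by
  have h : (x : E3) 0 ^ 2 + (x : E3) 1 ^ 2 + (x : E3) 2 ^ 2 = 1 := by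
    rw [← norm_sq_E3, norm_eq_of_mem_sphere, one_pow]
  set z : ℂ := ⟨(x : E3) 0, (x : E3) 1⟩ with hz
  have hn : ‖z‖ ^ 2 = (x : E3) 0 ^ 2 + (x : E3) 1 ^ 2 := by
    rw [← Complex.normSq_eq_norm_sq, Complex.normSq_apply]; simp [hz]; ring
  have h2 : (x : E3) 2 ^ 2 ≤ 1 := by nlinarith [sq_nonneg ((x : E3) 0), sq_nonneg ((x : E3) 1)]
  have h3 := (sq_le_one_iff_abs_le_one _).1 h2
  have hsin : Real.sin (Real.arccos ((x : E3) 2)) = ‖z‖ := by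
    rw [Real.sin_arccos, ← Real.sqrt_sq (norm_nonneg z), hn]
    congr 1; linarith
  refine ⟨Real.arccos ((x : E3) 2), ⟨Real.arccos_nonneg _, Real.arccos_le_pi _⟩, z.arg, ?_⟩
  ext i
  fin_cases i
  · simp [sphericalPoint, hsin, Complex.norm_mul_cos_arg]; rfl
  · simp [sphericalPoint, hsin, Complex.norm_mul_sin_arg]; rfl
  · simp [sphericalPoint, Real.cos_arccos (abs_le.1 h3).1 (abs_le.1 h3).2]

theorem exists_tangent_angle {a b : ℝ} {v : E3} (hv : ‖v‖ = 1) (h : ⟪sphericalPoint a b, v⟫ = 0) :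
    ∃ ξ : ℝ, v = Real.cos ξ • frameA a b + Real.sin ξ • frameB b := by
  have ha := Real.sin_sq_add_cos_sq a
  have hb := Real.sin_sq_add_cos_sq b
  have hdec : v = ⟪frameA a b, v⟫ • frameA a b + ⟪frameB b, v⟫ • frameB b := by
    rw [inner_E3] at h
    simp only [inner_E3, sphericalPoint, frameA, frameB, Matrix.cons_val] at h ⊢
    ext i
    fin_cases i <;> simp
    · linear_combination Real.sin a * Real.cos b * h - Real.cos b ^ 2 * v 0 * ha - v 0 * hb -
        Real.cos b * Real.sin b * v 1 * ha
    · linear_combination Real.sin a * Real.sin b * h - Real.sin b ^ 2 * v 1 * ha - v 1 * hb -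
        Real.cos b * Real.sin b * v 0 * ha
    · linear_combination Real.cos a * h - v 2 * ha
  have hA : ‖frameA a b‖ ^ 2 = 1 := by
    simp only [norm_sq_E3, frameA, Matrix.cons_val]
    grind
  have hB : ‖frameB b‖ ^ 2 = 1 := by
    simp only [norm_sq_E3, frameB, Matrix.cons_val]
    grind
  have hAB : ⟪frameA a b, frameB b⟫ = 0 := by
    simp only [inner_E3, frameA, frameB, Matrix.cons_val]
    ring
  set s := ⟪frameA a b, v⟫
  set t := ⟪frameB b, v⟫
  have hst : s ^ 2 + t ^ 2 = 1 := by
    have := real_inner_self_eq_norm_sq v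
    rw [hv, hdec] at this
    simp only [inner_add_left, inner_add_right, inner_smul_left, inner_smul_right, hAB,
      real_inner_comm (frameA a b), real_inner_self_eq_norm_sq, hA, hB] at this
    simp at this
    linarith
  set z : ℂ := ⟨s, t⟩ with hz
  have hn : ‖z‖ = 1 := by
    rw [← sq_eq_sq₀ (norm_nonneg _) zero_le_one, ← Complex.normSq_eq_norm_sq, Complex.normSq_apply]
    simp [hz]; linarith
  refine ⟨z.arg, ?_⟩
  have h1 := Complex.norm_mul_cos_arg z
  have h2 := Complex.norm_mul_sin_arg z
  rw [hn, one_mul] at h1 h2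
  rw [h1, h2]
  exact hdec

/-! ### The map from `SU(2)` to the bundle of directions and its differential -/

theorem contMDiff_quat : ContMDiff (𝓡 3) 𝓘(ℝ, E4) ∞ quat :=
  have : Fact (Module.finrank ℝ E4 = 3 + 1) := ⟨finrank_euclideanSpace_fin⟩
  contMDiff_coe_sphere.comp (contMDiff_homeomorph_symm sphereHomeoSU2 (I := 𝓡 3))

/-- The derivative of the quaternion coordinates. -/
def dquat (g : SU2) : TangentSpace (𝓡 3) g →L[ℝ] E4 := mvfderiv (𝓡 3) quat g

theorem dquat_eq (g : SU2) (v : TangentSpace (𝓡 3) g) : dquat g v =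
    mvfderiv (𝓡 3) (fun x : sphere (0 : E4) 1 => (x : E4)) (sphereHomeoSU2.symm g)
      (mfderiv (𝓡 3) (𝓡 3) sphereHomeoSU2.symm g v) := by
  have : Fact (Module.finrank ℝ E4 = 3 + 1) := ⟨finrank_euclideanSpace_fin⟩
  have h1 : MDifferentiableAt (𝓡 3) 𝓘(ℝ, E4) (fun x : sphere (0 : E4) 1 => (x : E4))
      (sphereHomeoSU2.symm g) := (contMDiff_coe_sphere _).mdifferentiableAt one_ne_zero
  have h2 : MDifferentiableAt (𝓡 3) (𝓡 3) sphereHomeoSU2.symm g :=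
    (contMDiff_homeomorph_symm sphereHomeoSU2 (I := 𝓡 3)).mdifferentiableAt (by simp)
  exact mfderiv_comp_apply g h1 h2 v

theorem inner_quat_dquat (g : SU2) (v : TangentSpace (𝓡 3) g) : ⟪quat g, dquat g v⟫ = 0 := by
  have : Fact (Module.finrank ℝ E4 = 3 + 1) := ⟨finrank_euclideanSpace_fin⟩
  rw [dquat_eq, ← Submodule.mem_orthogonal_singleton_iff_inner_right]
  have := range_mvfderiv_subtypeVal (n := 3) (sphereHomeoSU2.symm g)
  unfold quat
  rw [← this]
  exact ⟨_, rfl⟩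

theorem dquat_injective (g : SU2) : Function.Injective (dquat g) := by
  have : Fact (Module.finrank ℝ E4 = 3 + 1) := ⟨finrank_euclideanSpace_fin⟩
  rw [injective_iff_map_eq_zero]
  intro v hv
  rw [dquat_eq] at hv
  have h1 := injective_mvfderiv_subtypeVal_sphere (n := 3) (sphereHomeoSU2.symm g)
    (hv.trans (map_zero _).symm)
  have h2 := mfderiv_comp_apply (I := 𝓡 3) (I' := 𝓡 3) (I'' := 𝓡 3) g
    (g := sphereHomeoSU2) (f := sphereHomeoSU2.symm)
    ((contMDiff_homeomorph sphereHomeoSU2 (I := 𝓡 3)).mdifferentiableAt (by simp))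
    ((contMDiff_homeomorph_symm sphereHomeoSU2 (I := 𝓡 3)).mdifferentiableAt (by simp)) v
  rw [h1, map_zero] at h2
  have h3 : (sphereHomeoSU2 ∘ sphereHomeoSU2.symm : SU2 → SU2) = id := by ext1 x; simp
  rw [h3, mfderiv_id] at h2
  exact h2

/-- The conjugate of a quaternion. -/
def quatConj (x : E4) : E4 := !₂[x 0, -x 1, -x 2, -x 3]

/-- The quaternion of `g⁻¹ v`; it is imaginary (`bodyVelocity_zero`). -/
def bodyVelocity (g : SU2) (v : TangentSpace (𝓡 3) g) : E4 :=
  quatMul (quatConj (quat g)) (dquat g v)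

theorem inner_E4 (x y : E4) : ⟪x, y⟫ = x 0 * y 0 + x 1 * y 1 + x 2 * y 2 + x 3 * y 3 := by
  simp [PiLp.inner_apply, Fin.sum_univ_four, mul_comm]

theorem quatMul_quatConj (x y : E4) : quatMul x (quatMul (quatConj x) y) =
    (x 0 ^ 2 + x 1 ^ 2 + x 2 ^ 2 + x 3 ^ 2) • y := by
  ext i
  fin_cases i <;> simp [quatMul, quatConj] <;> ring

theorem bodyVelocity_zero (g : SU2) (v : TangentSpace (𝓡 3) g) : bodyVelocity g v 0 = 0 := by
  have h := inner_quat_dquat g v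
  rw [inner_E4] at h
  simp [bodyVelocity, quatMul, quatConj]
  linarith

theorem eq_zero_of_bodyVelocity {g : SU2} {v : TangentSpace (𝓡 3) g} (h1 : bodyVelocity g v 1 = 0)
    (h2 : bodyVelocity g v 2 = 0) (h3 : bodyVelocity g v 3 = 0) : v = 0 := by
  have h0 := bodyVelocity_zero g v
  have hz : bodyVelocity g v = 0 := by ext i; fin_cases i <;> simpa
  have h := quatMul_quatConj (quat g) (dquat g v)
  rw [quat_sq, one_smul] at h
  change quatMul (quat g) (bodyVelocity g v) = _ at h
  apply dquat_injective g
  rw [map_zero, ← h, hz]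
  ext i
  fin_cases i <;> simp [quatMul]

/-- The entries of the matrix of a quaternion are linear. -/
def quatEntry (i j : Fin 2) : E4 →L[ℝ] ℂ := LinearMap.toContinuousLinearMap
  { toFun := fun x => quatMatrix x i j
    map_add' := fun x y => by
      fin_cases i <;> fin_cases j <;> apply Complex.ext <;> simp [quatMatrix] <;> ring
    map_smul' := fun c x => by
      fin_cases i <;> fin_cases j <;> apply Complex.ext <;> simp [quatMatrix] }

theorem mvfderiv_clm_comp {E F : Type*} [NormedAddCommGroup E] [NormedSpace ℝ E]
    [NormedAddCommGroup F] [NormedSpace ℝ F] {E' : Type*} [NormedAddCommGroup E']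
    [NormedSpace ℝ E'] {H : Type*} [TopologicalSpace H] {I : ModelWithCorners ℝ E' H} {M : Type*}
    [TopologicalSpace M] [ChartedSpace H M] {f : M → E} {x : M} {P : E → F}
    (hP : DifferentiableAt ℝ P (f x)) (hf : MDifferentiableAt I 𝓘(ℝ, E) f x)
    (v : TangentSpace I x) :
    mvfderiv I (fun y => P (f y)) x v = fderiv ℝ P (f x) (mvfderiv I f x v) := by
  have := mfderiv_comp_apply (g := P) (f := f) x hP.mdifferentiableAt hf v
  rw [mfderiv_eq_fderiv] at this
  exact this

theorem mdifferentiableAt_quat (g : SU2) : MDifferentiableAt (𝓡 3) 𝓘(ℝ, E4) quat g :=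
  contMDiff_quat.mdifferentiableAt (by simp)

theorem leftTrivialization_eq (g : SU2) (v : TangentSpace (𝓡 3) g) :
    leftTrivialization g v = quatMatrix (bodyVelocity g v) := by
  have h1 : (Matrix.of fun i j => mvfderiv (𝓡 3) (fun h : SU2 => (h : Mat2) i j) g v) =
      quatMatrix (dquat g v) := by
    ext i j
    have h2 : (fun h : SU2 => (h : Mat2) i j) = fun h => quatEntry i j (quat h) := by
      ext1 h
      change _ = quatMatrix (quat h) i j
      rw [quatMatrix_quat]
    rw [Matrix.of_apply, h2, mvfderiv_clm_comp (quatEntry i j).differentiableAt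
      (mdifferentiableAt_quat g), ContinuousLinearMap.fderiv]
    rfl
  have h3 : ((g⁻¹ : SU2) : Mat2) = quatMatrix (quatConj (quat g)) := by
    change star (g : Mat2) = _
    rw [← quatMatrix_quat g]
    ext i j
    fin_cases i <;> fin_cases j <;> apply Complex.ext <;>
      simp [quatMatrix, quatConj, Matrix.star_apply]
  change ((g⁻¹ : SU2) : Mat2) * _ = _
  rw [h1, h3, quatMatrix_mul]
  rfl

theorem mem_distSU2_iff {g : SU2} {v : TangentSpace (𝓡 3) g} :
    v ∈ distSU2 g ↔ bodyVelocity g v 1 = 0 := by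
  have h0 := bodyVelocity_zero g v
  have hp : ∀ a b : ℝ, a • (p₁ : Mat2) + b • (p₂ : Mat2) = quatMatrix !₂[0, 0, a / 2, b / 2] := by
    intro a b
    ext i j
    fin_cases i <;> fin_cases j <;> apply Complex.ext <;> simp [quatMatrix, p₁, p₂] <;> ring
  change leftTrivialization g v ∈ pSpace ↔ _
  rw [leftTrivialization_eq, pSpace, Submodule.mem_span_pair]
  constructor
  · rintro ⟨a, b, h⟩
    rw [hp] at h
    rw [← quatMatrix_injective h]
    simp
  · intro h1
    refine ⟨2 * bodyVelocity g v 2, 2 * bodyVelocity g v 3, ?_⟩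
    rw [hp]
    congr 1
    ext i
    fin_cases i <;> simp [h0, h1]

theorem metricSU2_self (g : SU2) (v : TangentSpace (𝓡 3) g) : metricSU2 g v v =
    (2 * bodyVelocity g v 1) ^ 2 + (2 * bodyVelocity g v 2) ^ 2 + (2 * bodyVelocity g v 3) ^ 2 := by
  have h0 := bodyVelocity_zero g v
  rw [metricSU2, leftTrivialization_eq, killing, Matrix.trace_fin_two]
  simp [quatMatrix, Matrix.mul_apply, Fin.sum_univ_two, h0]
  ring

theorem hasDerivAt_quadratic {E : Type*} [NormedAddCommGroup E] [NormedSpace ℝ E] (a b c : E) :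
    HasDerivAt (fun t : ℝ => a + t • b + t ^ 2 • c) b 0 := by
  have h1 := (hasDerivAt_id (0 : ℝ)).smul_const b
  have h2 := (hasDerivAt_pow 2 (0 : ℝ)).smul_const c
  have : HasDerivAt (fun t : ℝ => a + t • b + t ^ 2 • c) _ 0 := (h1.const_add a).add h2
  simpa using this

/-- The differential of a quadratic map is read off its polarization. -/
theorem fderiv_of_quadratic {Q : E4 → E3} {x y : E4} {D : E3} (hQ : DifferentiableAt ℝ Q x)
    (h : ∀ t : ℝ, Q (x + t • y) = Q x + t • D + t ^ 2 • Q y) : fderiv ℝ Q x y = D := by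
  have h1 := hQ.hasFDerivAt.hasLineDerivAt y
  rw [HasLineDerivAt] at h1
  simp only [h] at h1
  exact h1.unique (hasDerivAt_quadratic _ _ _)

theorem contDiff_baseVec : ContDiff ℝ ∞ baseVec := by
  rw [contDiff_euclidean]
  intro i
  fin_cases i <;> simp [baseVec] <;> fun_prop

theorem contDiff_dirVec : ContDiff ℝ ∞ dirVec := by
  rw [contDiff_euclidean]
  intro i
  fin_cases i <;> simp [dirVec] <;> fun_prop

/-- With `z = x̄ y`, this is the conjugate by `x` of the commutator `z k - k z`. -/
theorem fderiv_baseVec {x y : E4} (hx : x 0 ^ 2 + x 1 ^ 2 + x 2 ^ 2 + x 3 ^ 2 = 1)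
    (hxy : ⟪x, y⟫ = 0) : fderiv ℝ baseVec x y =
      (2 * quatMul (quatConj x) y 2) • dirVec x -
        (2 * quatMul (quatConj x) y 1) • conormalVec x := by
  rw [fderiv_of_quadratic (contDiff_baseVec.differentiable (by simp) x)
    (D := !₂[2 * (x 1 * y 3 + y 1 * x 3 + x 0 * y 2 + y 0 * x 2),
      -(2 * (x 2 * y 3 + y 2 * x 3 - x 0 * y 1 - y 0 * x 1)),
      2 * (x 0 * y 0 - x 1 * y 1 - x 2 * y 2 + x 3 * y 3)])]
  · rw [inner_E4] at hxy
    ext i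
    fin_cases i <;> simp [quatMul, quatConj, dirVec, conormalVec]
    · linear_combination -(2 * (x 1 * y 3 + y 1 * x 3 + x 0 * y 2 + y 0 * x 2)) * hx +
        2 * (2 * (x 1 * x 3 + x 0 * x 2)) * hxy
    · linear_combination (2 * (x 2 * y 3 + y 2 * x 3 - x 0 * y 1 - y 0 * x 1)) * hx -
        2 * (2 * (x 2 * x 3 - x 0 * x 1)) * hxy
    · linear_combination -(2 * (x 0 * y 0 - x 1 * y 1 - x 2 * y 2 + x 3 * y 3)) * hx +
        2 * (x 0 ^ 2 - x 1 ^ 2 - x 2 ^ 2 + x 3 ^ 2) * hxy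
  · intro t
    ext i
    fin_cases i <;> simp [baseVec] <;> ring

/-- With `z = x̄ y`, this is the conjugate by `x` of the commutator `z i - i z`. -/
theorem fderiv_dirVec {x y : E4} (hx : x 0 ^ 2 + x 1 ^ 2 + x 2 ^ 2 + x 3 ^ 2 = 1)
    (hxy : ⟪x, y⟫ = 0) : fderiv ℝ dirVec x y =
      (2 * quatMul (quatConj x) y 3) • conormalVec x -
        (2 * quatMul (quatConj x) y 2) • baseVec x := by
  rw [fderiv_of_quadratic (contDiff_dirVec.differentiable (by simp) x)
    (D := !₂[2 * (x 0 * y 0 + x 1 * y 1 - x 2 * y 2 - x 3 * y 3),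
      -(2 * (x 1 * y 2 + y 1 * x 2 + x 0 * y 3 + y 0 * x 3)),
      2 * (x 1 * y 3 + y 1 * x 3 - x 0 * y 2 - y 0 * x 2)])]
  · rw [inner_E4] at hxy
    ext i
    fin_cases i <;> simp [quatMul, quatConj, baseVec, conormalVec]
    · linear_combination -(2 * (x 0 * y 0 + x 1 * y 1 - x 2 * y 2 - x 3 * y 3)) * hx +
        2 * (x 0 ^ 2 + x 1 ^ 2 - x 2 ^ 2 - x 3 ^ 2) * hxy
    · linear_combination (2 * (x 1 * y 2 + y 1 * x 2 + x 0 * y 3 + y 0 * x 3)) * hx -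
        2 * (2 * (x 1 * x 2 + x 0 * x 3)) * hxy
    · linear_combination -(2 * (x 1 * y 3 + y 1 * x 3 - x 0 * y 2 - y 0 * x 2)) * hx +
        2 * (2 * (x 1 * x 3 - x 0 * x 2)) * hxy
  · intro t
    ext i
    fin_cases i <;> simp [dirVec] <;> ring

/-- The base point of the direction associated with `g`: the conjugate of `k` by `g`. -/
def basePoint (g : SU2) : S2 := ⟨baseVec (quat g), by
  rw [mem_sphere_zero_iff_norm, norm_baseVec (quat_sq g)]⟩

theorem dirVec_ne_zero (g : SU2) : dirVec (quat g) ≠ 0 := fun h => by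
  have := norm_dirVec (quat_sq g)
  rw [h, norm_zero] at this
  exact zero_ne_one this

/-- The direction associated with `g`: at the conjugate of `k`, the line of the conjugate of `i`. -/
def toPTS2 (g : SU2) : PTS2 :=
  ⟨basePoint g, (exists_line (x := basePoint g) (dirVec_ne_zero g)
    (inner_baseVec_dirVec (quat g))).choose⟩

theorem line_toPTS2 (g : SU2) : line (toPTS2 g) = Submodule.span ℝ {dirVec (quat g)} :=
  (exists_line (x := basePoint g) (dirVec_ne_zero g) (inner_baseVec_dirVec (quat g))).choose_spec

theorem dirVec_mem_line (g : SU2) : dirVec (quat g) ∈ line (toPTS2 g) := by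
  rw [line_toPTS2]; exact Submodule.mem_span_singleton_self _

theorem contMDiff_toPTS2 : ContMDiff (𝓡 3) 𝓘(ℝ, E2 × ℝ) ∞ toPTS2 := by
  intro g
  rw [← contMDiffWithinAt_univ]
  exact contMDiffWithinAt_PTS2 le_rfl (mem_univ g)
    (contDiff_baseVec.contMDiff.comp contMDiff_quat).contMDiffAt.contMDiffWithinAt
    (contDiff_dirVec.contMDiff.comp contMDiff_quat).contMDiffAt.contMDiffWithinAt
    (fun h _ => dirVec_mem_line h) fun h _ => dirVec_ne_zero h

theorem mdifferentiableAt_toPTS2 (g : SU2) :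
    MDifferentiableAt (𝓡 3) 𝓘(ℝ, E2 × ℝ) toPTS2 g :=
  contMDiff_toPTS2.mdifferentiableAt (by simp)

theorem mdifferentiableAt_coe_base (q : PTS2) :
    MDifferentiableAt 𝓘(ℝ, E2 × ℝ) 𝓘(ℝ, E3) (fun q : PTS2 => (q.base : E3)) q :=
  contMDiff_coe_base.mdifferentiableAt (by simp)

theorem mvfderiv_base_toPTS2 (g : SU2) (v : TangentSpace (𝓡 3) g) :
    mvfderiv 𝓘(ℝ, E2 × ℝ) (fun r : PTS2 => (r.base : E3)) (toPTS2 g)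
      (mfderiv (𝓡 3) 𝓘(ℝ, E2 × ℝ) toPTS2 g v) =
      (2 * bodyVelocity g v 2) • dirVec (quat g) -
        (2 * bodyVelocity g v 1) • conormalVec (quat g) := by
  have h1 := mfderiv_comp_apply g (mdifferentiableAt_coe_base (toPTS2 g))
    (mdifferentiableAt_toPTS2 g) v
  have h2 := mvfderiv_clm_comp (contDiff_baseVec.differentiable (by simp) (quat g))
    (mdifferentiableAt_quat g) v
  exact h1.symm.trans (h2.trans (fderiv_baseVec (quat_sq g) (inner_quat_dquat g v)))

theorem covDerivUnit_toPTS2 (g : SU2) (v : TangentSpace (𝓡 3) g) : ∃ ε : ℝ, ε ^ 2 = 1 ∧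
    covDerivUnit (toPTS2 g) (mfderiv (𝓡 3) 𝓘(ℝ, E2 × ℝ) toPTS2 g v) =
      (ε * (2 * bodyVelocity g v 3)) • conormalVec (quat g) := by
  have hd : ContMDiff (𝓡 3) 𝓘(ℝ, E3) ∞ (fun h : SU2 => dirVec (quat h)) :=
    contDiff_dirVec.contMDiff.comp contMDiff_quat
  obtain ⟨ε, hε, hev⟩ := exists_unitToward_eq (φ := toPTS2) (mem_univ g)
    hd.continuous.continuousWithinAt (fun h _ => dirVec_mem_line h) fun h _ => dirVec_ne_zero h
  refine ⟨ε, hε, ?_⟩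
  -- near `g` the unit vector of the direction is `ε • dirVec`, whose derivative is known
  rw [nhdsWithin_univ] at hev
  have hev' : unitToward (unitVec (toPTS2 g)) ∘ toPTS2 =ᶠ[𝓝 g]
      fun h => (fun x : E4 => ε • dirVec x) (quat h) := by
    filter_upwards [hev] with h hh
    rw [Function.comp, hh, norm_dirVec (quat_sq h), inv_one, one_smul]
  have h1 := mfderiv_comp_apply g (mdifferentiableAt_unitToward (toPTS2 g))
    (mdifferentiableAt_toPTS2 g) v
  have hdd := contDiff_dirVec.differentiable (by simp) (quat g)
  have h2 := mvfderiv_clm_comp (P := fun x : E4 => ε • dirVec x) (hdd.const_smul ε)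
    (mdifferentiableAt_quat g) v
  have h3 : mvfderiv 𝓘(ℝ, E2 × ℝ) (unitToward (unitVec (toPTS2 g))) (toPTS2 g)
      (mfderiv (𝓡 3) 𝓘(ℝ, E2 × ℝ) toPTS2 g v) = ε • ((2 * bodyVelocity g v 3) •
        conormalVec (quat g) - (2 * bodyVelocity g v 2) • baseVec (quat g)) := by
    rw [hev'.mfderiv_eq] at h1
    refine h1.symm.trans (h2.trans ?_)
    rw [fderiv_fun_const_smul hdd]
    exact congrArg (fun w => ε • w) (fderiv_dirVec (quat_sq g) (inner_quat_dquat g v))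
  have hb : ((toPTS2 g).base : E3) = baseVec (quat g) := rfl
  rw [covDerivUnit, h3, hb, inner_smul_right, inner_sub_right, inner_smul_right, inner_smul_right,
    inner_baseVec_conormalVec, real_inner_self_eq_norm_sq, norm_baseVec (quat_sq g)]
  module

theorem norm_sub_smul_frame (g : SU2) (s t : ℝ) :
    ‖s • dirVec (quat g) - t • conormalVec (quat g)‖ ^ 2 = s ^ 2 + t ^ 2 := by
  rw [norm_sub_sq_real, norm_smul, norm_smul, norm_dirVec (quat_sq g),
    norm_conormalVec (quat_sq g), inner_smul_left, inner_smul_right, inner_dirVec_conormalVec]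
  simp

/-- The norms correspond for all tangent vectors, not only for the horizontal ones. -/
theorem normPTS2_toPTS2 (g : SU2) (v : TangentSpace (𝓡 3) g) :
    normPTS2 1 (toPTS2 g) (mfderiv (𝓡 3) 𝓘(ℝ, E2 × ℝ) toPTS2 g v) = √(metricSU2 g v v) := by
  obtain ⟨ε, hε, h⟩ := covDerivUnit_toPTS2 g v
  rw [normPTS2, h, mvfderiv_base_toPTS2, norm_sub_smul_frame, metricSU2_self, norm_smul,
    norm_conormalVec (quat_sq g), Real.norm_eq_abs, mul_one, sq_abs, mul_pow ε, hε]
  congr 1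
  ring

/-- A vector in the kernel moves neither the base point nor the direction, which forces all three
components of `bodyVelocity` to vanish. -/
theorem mfderiv_toPTS2_injective (g : SU2) :
    Function.Injective (mfderiv (𝓡 3) 𝓘(ℝ, E2 × ℝ) toPTS2 g) := by
  rw [injective_iff_map_eq_zero]
  intro v hv
  have h := mvfderiv_base_toPTS2 g v
  obtain ⟨ε, hε, h'⟩ := covDerivUnit_toPTS2 g v
  rw [hv, map_zero] at h
  have h1 := norm_sub_smul_frame g (2 * bodyVelocity g v 2) (2 * bodyVelocity g v 1)
  rw [← h, norm_zero] at h1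
  rw [hv, covDerivUnit, map_zero, inner_zero_right, zero_smul, sub_zero] at h'
  have h3 := congrArg (fun w => ‖w‖ ^ 2) h'
  simp only [norm_smul, norm_conormalVec (quat_sq g), Real.norm_eq_abs, mul_one, sq_abs,
    norm_zero, mul_pow ε, hε] at h3
  exact eq_zero_of_bodyVelocity (by nlinarith) (by nlinarith) (by nlinarith)

theorem mem_dir_iff {q : PTS2} {w : TangentSpace (𝓡 2) q.base} :
    w ∈ q.dir.submodule ↔ toAmbient q.base w ∈ line q := by
  constructor
  · exact fun h => ⟨w, h, rfl⟩
  · rintro ⟨w', h, hw⟩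
    rwa [← toAmbient_injective q.base hw]

theorem mem_distPTS2_iff {q : PTS2} {V : TangentSpace 𝓘(ℝ, E2 × ℝ) q} :
    V ∈ distPTS2 q ↔ mvfderiv 𝓘(ℝ, E2 × ℝ) (fun r : PTS2 => (r.base : E3)) q V ∈ line q := by
  have h := mfderiv_comp_apply q (contMDiff_coe_S2.mdifferentiableAt (x := q.base) (by simp))
    (contMDiff_base.mdifferentiableAt (x := q) (by simp)) V
  have h' : mvfderiv 𝓘(ℝ, E2 × ℝ) (fun r : PTS2 => (r.base : E3)) q V = toAmbient q.base
    (mfderiv 𝓘(ℝ, E2 × ℝ) (𝓡 2) (ProjTangent.base : PTS2 → S2) q V) := h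
  rw [h', ← mem_dir_iff]
  rfl

theorem mfderiv_toPTS2_mem_iff {g : SU2} {v : TangentSpace (𝓡 3) g} :
    mfderiv (𝓡 3) 𝓘(ℝ, E2 × ℝ) toPTS2 g v ∈ distPTS2 (toPTS2 g) ↔ v ∈ distSU2 g := by
  rw [mem_distPTS2_iff, mvfderiv_base_toPTS2, mem_distSU2_iff, line_toPTS2,
    Submodule.mem_span_singleton]
  constructor
  · rintro ⟨r, hr⟩
    have h := congrArg (fun w => ⟪conormalVec (quat g), w⟫) hr
    simp only [inner_sub_right, inner_smul_right, real_inner_self_eq_norm_sq,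
      norm_conormalVec (quat_sq g), real_inner_comm (dirVec (quat g)),
      inner_dirVec_conormalVec] at h
    linarith
  · intro h
    exact ⟨2 * bodyVelocity g v 2, by rw [h, mul_zero, zero_smul, sub_zero]⟩

/-! ### The diffeomorphism between `L(4,1)` and `PTS²` -/

/-- Right multiplication by `k` fixes the base point and reverses the vector of the direction. -/
theorem toPTS2_mul_generator (g : SU2) : toPTS2 (g * expSU2 (Real.pi • p₂)) = toPTS2 g := by
  have hk : quat (expSU2 (Real.pi • p₂)) = !₂[0, 0, 0, 1] := by rw [quat_expSU2_p₂]; simp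
  apply ProjTangent.ext_line
  · apply Subtype.ext
    change baseVec (quat _) = baseVec (quat g)
    rw [quat_mul, hk, baseVec_quatMul]
    simp
  · have : dirVec (quat (g * expSU2 (Real.pi • p₂))) = (-1 : ℝ) • dirVec (quat g) := by
      rw [quat_mul, hk, dirVec_quatMul]
      simp
    rw [line_toPTS2, line_toPTS2, this,
      Submodule.span_singleton_smul_eq (IsUnit.mk0 _ (by norm_num))]

theorem toPTS2_mul_of_mem {h : SU2} (hh : h ∈ lensSubgroup) (g : SU2) :
    toPTS2 (g * h) = toPTS2 g := by
  obtain ⟨n, rfl⟩ := hh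
  change toPTS2 (g * expSU2 (Real.pi • p₂) ^ n) = _
  induction n using Int.induction_on generalizing g with
  | zero => rw [zpow_zero, mul_one]
  | succ n ih => rw [zpow_add_one, ← mul_assoc, toPTS2_mul_generator, ih]
  | pred n ih =>
    rw [← ih g, zpow_sub_one, ← mul_assoc, ← toPTS2_mul_generator (_ * _⁻¹),
      inv_mul_cancel_right]

theorem toPTS2_eq_iff {g h : SU2} : toPTS2 g = toPTS2 h ↔ lensProj g = lensProj h := by
  constructor
  · intro e
    refine QuotientGroup.eq.2 ?_
    have hb : baseVec (quat g) = baseVec (quat h) :=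
      congrArg (fun q : PTS2 => (q.base : E3)) e
    have hd : dirVec (quat h) ∈ line (toPTS2 g) := e ▸ dirVec_mem_line h
    rw [line_toPTS2] at hd
    obtain ⟨r, hr⟩ := Submodule.mem_span_singleton.1 hd
    exact inv_mul_mem_lensSubgroup hb hr.symm
  · intro e
    have := toPTS2_mul_of_mem (QuotientGroup.eq.1 e) g
    rw [mul_inv_cancel_left] at this
    exact this.symm

theorem hasCoords_toPTS2 (a b c : ℝ) : HasCoords (toPTS2 (eulerSU2 a b c)) a b (-c) :=
  ⟨baseVec_eulerSU2 a b c, by rw [line_toPTS2, dirVec_eulerSU2]⟩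

theorem toPTS2_surjective : Function.Surjective toPTS2 := by
  intro q
  obtain ⟨a, -, b, hab⟩ := exists_sphericalPoint q.base
  have h := inner_base_of_mem_line (unitVec_mem_line q)
  rw [hab] at h
  obtain ⟨ξ, hξ⟩ := exists_tangent_angle (norm_unitVec q) h
  obtain ⟨h1, h2⟩ := hasCoords_toPTS2 a b (-ξ)
  refine ⟨eulerSU2 a b (-ξ), ProjTangent.ext_line (Subtype.ext (h1.trans hab.symm)) ?_⟩
  rw [h2, neg_neg, ← hξ, line_eq_span (unitVec_mem_line q) (unitVec_ne_zero q)]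

theorem lensProj_out (q : L41) : lensProj (Quotient.out q) = q := Quotient.out_eq q

/-- The bijection `L(4,1) → PTS²` induced by `toPTS2`, evaluated on the representative used by
`distL41` and `metricL41`. -/
def lensEquiv : L41 ≃ PTS2 := Equiv.ofBijective (fun q => toPTS2 (Quotient.out q)) <| by
  constructor
  · intro q q' h
    rw [← lensProj_out q, ← lensProj_out q', ← toPTS2_eq_iff]
    exact h
  · intro r
    obtain ⟨g, rfl⟩ := toPTS2_surjective r
    exact ⟨lensProj g, toPTS2_eq_iff.2 (lensProj_out _)⟩

theorem lensEquiv_lensProj (g : SU2) : lensEquiv (lensProj g) = toPTS2 g :=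
  toPTS2_eq_iff.2 (lensProj_out _)

theorem contMDiff_lensEquiv : ContMDiff (𝓡 3) 𝓘(ℝ, E2 × ℝ) ∞ lensEquiv := by
  intro q
  obtain ⟨σ, hσ, hev⟩ := exists_section_lensProj q
  refine (contMDiff_toPTS2.contMDiffAt.comp q hσ).congr_of_eventuallyEq ?_
  filter_upwards [hev] with z hz
  rw [Function.comp, ← lensEquiv_lensProj, hz]

theorem mfderiv_lensEquiv_comp (g : SU2) (q : L41) (hq : lensProj g = q)
    (v : TangentSpace (𝓡 3) g) :
    mfderiv (𝓡 3) 𝓘(ℝ, E2 × ℝ) lensEquiv q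
      ((mfderiv (𝓡 3) (𝓡 3) lensProj g : E3 →L[ℝ] E3) v : E3) =
      (mfderiv (𝓡 3) 𝓘(ℝ, E2 × ℝ) toPTS2 g : E3 →L[ℝ] E2 × ℝ) v := by
  subst hq
  have h := mfderiv_comp_apply g (contMDiff_lensEquiv.mdifferentiableAt (by simp))
    (contMDiff_lensProj.mdifferentiableAt (by simp)) v
  have h' : lensEquiv ∘ lensProj = toPTS2 := funext lensEquiv_lensProj
  rw [h'] at h
  exact h.symm

theorem mfderiv_lensEquiv_dLensProj (q : L41) (v : TangentSpace (𝓡 3) (Quotient.out q)) :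
    mfderiv (𝓡 3) 𝓘(ℝ, E2 × ℝ) lensEquiv q (dLensProj q v) =
      mfderiv (𝓡 3) 𝓘(ℝ, E2 × ℝ) toPTS2 (Quotient.out q) v :=
  mfderiv_lensEquiv_comp (Quotient.out q) q (lensProj_out q) v

section FiniteDimensional
variable {E F : Type*} [NormedAddCommGroup E] [NormedSpace ℝ E] [FiniteDimensional ℝ E]
  [NormedAddCommGroup F] [NormedSpace ℝ F]

theorem bijective_of_injective_of_finrank_eq [FiniteDimensional ℝ F] (L : E →L[ℝ] F)
    (h : Function.Injective L) (hr : Module.finrank ℝ E = Module.finrank ℝ F) : Function.Bijective L :=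
  ⟨h, (LinearMap.injective_iff_surjective_of_finrank_eq_finrank hr (f := (L : E →ₗ[ℝ] F))).1 h⟩

theorem inverse_apply_of_bijective (L : E →L[ℝ] F) (h : Function.Bijective L) (v : E) :
    L.inverse (L v) = v := by
  let e : E ≃L[ℝ] F := (LinearEquiv.ofBijective (L : E →ₗ[ℝ] F) h).toContinuousLinearEquiv
  have hL : L = (e : E →L[ℝ] F) := by ext1 v; rfl
  rw [hL, ContinuousLinearMap.inverse_equiv]
  exact e.symm_apply_apply v

end FiniteDimensional

theorem dLensProj_injective (q : L41) : Function.Injective (dLensProj q) := by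
  intro v w h
  apply mfderiv_toPTS2_injective (Quotient.out q)
  rw [← mfderiv_lensEquiv_dLensProj, ← mfderiv_lensEquiv_dLensProj, h]

theorem dLensProj_bijective (q : L41) : Function.Bijective (dLensProj q) :=
  bijective_of_injective_of_finrank_eq (E := E3) (F := E3) (dLensProj q) (dLensProj_injective q) rfl

theorem dLensProj_inverse (q : L41) (v : TangentSpace (𝓡 3) (Quotient.out q)) :
    (dLensProj q).inverse (dLensProj q v) = v :=
  inverse_apply_of_bijective (E := E3) (F := E3) (dLensProj q) (dLensProj_bijective q) v

theorem mfderiv_lensEquiv_bijective (q : L41) :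
    Function.Bijective (mfderiv (𝓡 3) 𝓘(ℝ, E2 × ℝ) lensEquiv q) := by
  have hinj : Function.Injective (mfderiv (𝓡 3) 𝓘(ℝ, E2 × ℝ) lensEquiv q) := by
    intro V W h
    obtain ⟨v, rfl⟩ := (dLensProj_bijective q).2 V
    obtain ⟨w, rfl⟩ := (dLensProj_bijective q).2 W
    rw [mfderiv_lensEquiv_dLensProj, mfderiv_lensEquiv_dLensProj] at h
    rw [mfderiv_toPTS2_injective _ h]
  exact bijective_of_injective_of_finrank_eq (E := E3) (F := E2 × ℝ)
    (mfderiv (𝓡 3) 𝓘(ℝ, E2 × ℝ) lensEquiv q) hinj (by simp)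

/-- The diffeomorphism from `L(4,1)` to `PTS²`. -/
def lensDiffeo : Diffeomorph (𝓡 3) 𝓘(ℝ, E2 × ℝ) L41 PTS2 ∞ :=
  diffeomorphOfEquiv lensEquiv contMDiff_lensEquiv mfderiv_lensEquiv_bijective

theorem mfderiv_lensDiffeo_mem_iff {q : L41} {V : TangentSpace (𝓡 3) q} :
    mfderiv (𝓡 3) 𝓘(ℝ, E2 × ℝ) lensDiffeo q V ∈ distPTS2 (lensDiffeo q) ↔ V ∈ distL41 q := by
  obtain ⟨v, rfl⟩ := (dLensProj_bijective q).2 V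
  have h1 : dLensProj q v ∈ distL41 q ↔ v ∈ distSU2 (Quotient.out q) := by
    constructor
    · rintro ⟨w, hw, h⟩
      rwa [← dLensProj_injective q h]
    · exact fun h => ⟨v, h, rfl⟩
  rw [h1, ← mfderiv_toPTS2_mem_iff, ← mfderiv_lensEquiv_dLensProj]
  rfl

theorem normPTS2_lensDiffeo (q : L41) (V : TangentSpace (𝓡 3) q) :
    normPTS2 1 (lensDiffeo q) (mfderiv (𝓡 3) 𝓘(ℝ, E2 × ℝ) lensDiffeo q V) = normL41 q V := by
  obtain ⟨v, rfl⟩ := (dLensProj_bijective q).2 V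
  rw [normL41, metricL41, dLensProj_inverse, ← normPTS2_toPTS2, ← mfderiv_lensEquiv_dLensProj]
  rfl

theorem isHorizontal_lensDiffeo_iff {T : ℝ} (hT : 0 < T) {γ : ℝ → L41} :
    IsHorizontal (𝓡 3) distL41 T γ ↔
      IsHorizontal 𝓘(ℝ, E2 × ℝ) distPTS2 T (fun t => lensDiffeo (γ t)) := by
  have : IsManifold (𝓡 3) 1 L41 := .of_le (n := ∞) (by simp)
  have : IsManifold 𝓘(ℝ, E2 × ℝ) 1 PTS2 := .of_le (n := ∞) (by simp)
  refine and_congr ⟨fun h => h.comp (lensDiffeo.contMDiff.of_le (by simp)), fun h => ?_⟩ ?_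
  · have := h.comp (lensDiffeo.symm.contMDiff.of_le (by simp))
    simpa using this
  · refine Filter.eventually_congr ?_
    filter_upwards [ae_restrict_mem measurableSet_Icc] with t ht
    rw [velocity_diffeomorph hT ht, mfderiv_lensDiffeo_mem_iff]

theorem curveLength_lensDiffeo {T : ℝ} (hT : 0 < T) (γ : ℝ → L41) :
    curveLength (𝓡 3) normL41 T γ =
      curveLength 𝓘(ℝ, E2 × ℝ) (normPTS2 1) T (fun t => lensDiffeo (γ t)) := by
  refine lintegral_congr_ae ?_
  filter_upwards [ae_restrict_mem measurableSet_Icc] with t ht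
  rw [velocity_diffeomorph hT ht, normPTS2_lensDiffeo]

/-! ### Lifts of regular curves and geodesic curvature -/

/-- The mixed product of three vectors of `ℝ³`. -/
def mixedProduct (x v w : E3) : ℝ :=
  Matrix.det (Matrix.of ![fun i => x i, fun i => v i, fun i => w i])

theorem mixedProduct_eq (x v w : E3) : mixedProduct x v w =
    x 0 * (v 1 * w 2 - v 2 * w 1) - x 1 * (v 0 * w 2 - v 2 * w 0) +
      x 2 * (v 0 * w 1 - v 1 * w 0) := by
  rw [mixedProduct, Matrix.det_fin_three]
  simp
  ring

/-- A case of the Gram determinant. -/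
theorem mixedProduct_sq {x v w : E3} (hx : ‖x‖ = 1) (hxv : ⟪x, v⟫ = 0) (hxw : ⟪x, w⟫ = 0)
    (hvw : ⟪v, w⟫ = 0) : mixedProduct x v w ^ 2 = ‖v‖ ^ 2 * ‖w‖ ^ 2 := by
  have h : mixedProduct x v w ^ 2 = ‖x‖ ^ 2 * (‖v‖ ^ 2 * ‖w‖ ^ 2 - ⟪v, w⟫ ^ 2) -
      ⟪x, v⟫ * (⟪x, v⟫ * ‖w‖ ^ 2 - ⟪v, w⟫ * ⟪x, w⟫) +
      ⟪x, w⟫ * (⟪x, v⟫ * ⟪v, w⟫ - ‖v‖ ^ 2 * ⟪x, w⟫) := by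
    rw [mixedProduct_eq]
    simp only [inner_E3, norm_sq_E3]
    ring
  rw [h, hx, hxv, hxw, hvw]
  ring

/-- If `D` is the derivative of the unit tangent `w / ‖w‖` of a curve of the sphere at `x` with
velocity `w` and acceleration `a`, its tangential part has norm `|K| ‖w‖`. -/
theorem norm_sq_tangential {x w a D : E3} {r : ℝ} (hx : ‖x‖ = 1) (hw : w ≠ 0)
    (hxw : ⟪x, w⟫ = 0) (hD : D = ‖w‖⁻¹ • a + r • w) (hwD : ⟪w, D⟫ = 0) :
    ‖D - ⟪x, D⟫ • x‖ ^ 2 = geodesicCurvature x w a ^ 2 * ‖w‖ ^ 2 := by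
  have hm : ‖w‖ ≠ 0 := norm_ne_zero_iff.2 hw
  have h1 : ⟪x, D - ⟪x, D⟫ • x⟫ = 0 := by
    rw [inner_sub_right, inner_smul_right, real_inner_self_eq_norm_sq, hx]; ring
  have h2 : ⟪w, D - ⟪x, D⟫ • x⟫ = 0 := by
    rw [inner_sub_right, inner_smul_right, hwD, real_inner_comm x w, hxw]; ring
  have h3 := mixedProduct_sq hx hxw h1 h2
  have h4 : mixedProduct x w (D - ⟪x, D⟫ • x) = ‖w‖⁻¹ * mixedProduct x w a := by
    generalize ⟪x, D⟫ = s
    rw [hD, mixedProduct_eq, mixedProduct_eq]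
    simp
    ring
  rw [h4] at h3
  have h5 : geodesicCurvature x w a = mixedProduct x w a / ‖w‖ ^ 3 := rfl
  rw [h5]
  field_simp at h3 ⊢
  linarith

theorem velocity_eq_derivWithin {E : Type*} [NormedAddCommGroup E] [NormedSpace ℝ E] (T : ℝ)
    (c : ℝ → E) (t : ℝ) : velocity 𝓘(ℝ, E) T c t = derivWithin c (Icc 0 T) t := by
  rw [velocity, mfderivWithin_eq_fderivWithin, ← fderivWithin_derivWithin]
  rfl

section Lift
variable {T : ℝ} {Γ : ℝ → PTS2}

theorem IsRegularLift.contDiffOn (hΓ : IsRegularLift T Γ) :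
    ContDiffOn ℝ 2 (fun t => ((Γ t).base : E3)) (Icc 0 T) := by
  rw [← contMDiffOn_iff_contDiffOn]
  exact (contMDiff_coe_S2.of_le ENat.LEInfty.out).comp_contMDiffOn hΓ.1

theorem IsRegularLift.derivWithin_spec (hΓ : IsRegularLift T Γ) (hT : 0 < T) {t : ℝ}
    (ht : t ∈ Icc 0 T) :
    derivWithin (fun t => ((Γ t).base : E3)) (Icc 0 T) t ∈ line (Γ t) ∧
      derivWithin (fun t => ((Γ t).base : E3)) (Icc 0 T) t ≠ 0 := by
  obtain ⟨h0, hmem⟩ := hΓ.2 t ht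
  have h : derivWithin (fun t => ((Γ t).base : E3)) (Icc 0 T) t =
      toAmbient (Γ t).base (velocity (𝓡 2) T (fun s => (Γ s).base) t) := by
    rw [← velocity_eq_derivWithin]
    exact velocity_comp hT ht (contMDiff_coe_S2.mdifferentiableAt (by simp))
      ((hΓ.1 t ht).mdifferentiableWithinAt (by simp))
  rw [h]
  exact ⟨mem_dir_iff.1 hmem, fun h' => h0 (toAmbient_injective _ (h'.trans (map_zero _).symm))⟩

theorem IsRegularLift.contDiffOn_derivWithin (hΓ : IsRegularLift T Γ) (hT : 0 < T) :
    ContDiffOn ℝ 1 (derivWithin (fun t => ((Γ t).base : E3)) (Icc 0 T)) (Icc 0 T) :=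
  (hΓ.contDiffOn).derivWithin (uniqueDiffOn_Icc hT) (by norm_num)

theorem IsRegularLift.contMDiffOn (hΓ : IsRegularLift T Γ) (hT : 0 < T) :
    ContMDiffOn 𝓘(ℝ, ℝ) 𝓘(ℝ, E2 × ℝ) 1 Γ (Icc 0 T) := fun t ht =>
  contMDiffWithinAt_PTS2 (by simp) ht
    (contMDiffWithinAt_iff_contDiffWithinAt.2 ((hΓ.contDiffOn t ht).of_le (by norm_num)))
    (contMDiffWithinAt_iff_contDiffWithinAt.2 (hΓ.contDiffOn_derivWithin hT t ht))
    (fun _ hs => (hΓ.derivWithin_spec hT hs).1) fun _ hs => (hΓ.derivWithin_spec hT hs).2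

theorem IsRegularLift.mvfderiv_velocity (hΓ : IsRegularLift T Γ) (hT : 0 < T) {f : PTS2 → E3}
    {t : ℝ} (ht : t ∈ Icc 0 T)
    (hf : MDifferentiableAt 𝓘(ℝ, E2 × ℝ) 𝓘(ℝ, E3) f (Γ t)) :
    mvfderiv 𝓘(ℝ, E2 × ℝ) f (Γ t) (velocity 𝓘(ℝ, E2 × ℝ) T Γ t) =
      derivWithin (fun s => f (Γ s)) (Icc 0 T) t := by
  rw [← velocity_eq_derivWithin]
  exact (velocity_comp hT ht hf
    ((hΓ.contMDiffOn hT t ht).mdifferentiableWithinAt (by simp))).symm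

theorem IsRegularLift.isHorizontal (hΓ : IsRegularLift T Γ) (hT : 0 < T) :
    IsHorizontal 𝓘(ℝ, E2 × ℝ) distPTS2 T Γ := by
  have : IsManifold 𝓘(ℝ, E2 × ℝ) 1 PTS2 := .of_le (n := ∞) (by simp)
  refine ⟨isLipschitzCurve_of_contMDiffOn (hΓ.contMDiffOn hT), ?_⟩
  filter_upwards [ae_restrict_mem measurableSet_Icc] with t ht
  rw [mem_distPTS2_iff, hΓ.mvfderiv_velocity hT ht (mdifferentiableAt_coe_base _)]
  exact (hΓ.derivWithin_spec hT ht).1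

theorem IsRegularLift.norm_sq_covDerivUnit (hΓ : IsRegularLift T Γ) (hT : 0 < T) {t : ℝ}
    (ht : t ∈ Icc 0 T) :
    ‖covDerivUnit (Γ t) (velocity 𝓘(ℝ, E2 × ℝ) T Γ t)‖ ^ 2 =
      geodesicCurvature (Γ t).base (derivWithin (fun s => ((Γ s).base : E3)) (Icc 0 T) t)
        (iteratedDerivWithin 2 (fun s => ((Γ s).base : E3)) (Icc 0 T) t) ^ 2 *
      ‖derivWithin (fun s => ((Γ s).base : E3)) (Icc 0 T) t‖ ^ 2 := by
  have h2 : iteratedDerivWithin 2 (fun s => ((Γ s).base : E3)) (Icc 0 T) t =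
      derivWithin (derivWithin (fun s => ((Γ s).base : E3)) (Icc 0 T)) (Icc 0 T) t := by
    rw [iteratedDerivWithin_succ, iteratedDerivWithin_one]
  rw [h2]
  have hspec := fun s hs => hΓ.derivWithin_spec hT (t := s) hs
  have hcd := hΓ.contDiffOn_derivWithin hT
  set w := derivWithin (fun s => ((Γ s).base : E3)) (Icc 0 T)
  have hu : UniqueDiffWithinAt ℝ (Icc 0 T) t := uniqueDiffOn_Icc hT t ht
  have hw : HasDerivWithinAt w (derivWithin w (Icc 0 T) t) (Icc 0 T) t :=
    ((hcd t ht).differentiableWithinAt (by simp)).hasDerivWithinAt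
  obtain ⟨ε, hε, hev⟩ := exists_unitToward_eq ht hw.continuousWithinAt
    (fun s hs => (hspec s hs).1) fun s hs => (hspec s hs).2
  have hinv : DifferentiableWithinAt ℝ (fun s => ‖w s‖⁻¹) (Icc 0 T) t :=
    (hw.differentiableWithinAt.norm ℝ (hspec t ht).2).inv (norm_ne_zero_iff.2 (hspec t ht).2)
  have hn := hinv.hasDerivWithinAt.fun_smul hw
  set r := derivWithin (fun s => ‖w s‖⁻¹) (Icc 0 T) t
  set D := ‖w t‖⁻¹ • derivWithin w (Icc 0 T) t + r • w t with hD
  -- the unit tangent is orthogonal to its derivative `D`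
  have hconst : ⟪‖w t‖⁻¹ • w t, D⟫ = 0 := by
    have h3 := hn.inner ℝ hn
    have h4 : HasDerivWithinAt (fun _ => (1 : ℝ)) (⟪‖w t‖⁻¹ • w t, D⟫ + ⟪D, ‖w t‖⁻¹ • w t⟫)
        (Icc 0 T) t := by
      refine h3.congr_of_mem (fun s hs => ?_) ht
      have hm : ‖w s‖ ≠ 0 := norm_ne_zero_iff.2 (hspec s hs).2
      rw [real_inner_self_eq_norm_sq, norm_smul, norm_inv, norm_norm, inv_mul_cancel₀ hm, one_pow]
    have h5 := hu.eq_deriv _ h4 (hasDerivWithinAt_const t (Icc 0 T) (1 : ℝ))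
    rw [real_inner_comm (‖w t‖⁻¹ • w t) D] at h5
    linarith
  have hwD : ⟪w t, D⟫ = 0 := by
    rw [inner_smul_left] at hconst
    have hm : ‖w t‖⁻¹ ≠ 0 := inv_ne_zero (norm_ne_zero_iff.2 (hspec t ht).2)
    exact (mul_eq_zero.1 hconst).resolve_left (by simpa using hm)
  have hder : mvfderiv 𝓘(ℝ, E2 × ℝ) (unitToward (unitVec (Γ t))) (Γ t)
      (velocity 𝓘(ℝ, E2 × ℝ) T Γ t) = ε • D := by
    rw [hΓ.mvfderiv_velocity hT ht (mdifferentiableAt_unitToward _),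
      Filter.EventuallyEq.derivWithin_eq_of_mem hev ht]
    exact (hn.const_smul ε).derivWithin hu
  have hx : ‖((Γ t).base : E3)‖ = 1 := norm_eq_of_mem_sphere _
  rw [covDerivUnit, hder, inner_smul_right, mul_smul, ← smul_sub, norm_smul, mul_pow,
    Real.norm_eq_abs, sq_abs, hε, one_mul]
  exact norm_sq_tangential hx (hspec t ht).2 (inner_base_of_mem_line (hspec t ht).1) hD hwD

theorem IsRegularLift.curveLength_eq (hΓ : IsRegularLift T Γ) (hT : 0 < T) :
    curveLength 𝓘(ℝ, E2 × ℝ) (normPTS2 1) T Γ = curvatureCost 1 T (fun t => (Γ t).base) := by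
  refine lintegral_congr_ae ?_
  filter_upwards [ae_restrict_mem measurableSet_Icc] with t ht
  rw [normPTS2, hΓ.mvfderiv_velocity hT ht (mdifferentiableAt_coe_base _),
    hΓ.norm_sq_covDerivUnit hT ht, mul_assoc]

end Lift

end LensPTS

end

theorem theorem3 :
    ∃ f : Diffeomorph (𝓡 3) 𝓘(ℝ, E2 × ℝ) L41 PTS2 ∞,
      (∀ a ∈ Icc (0 : ℝ) Real.pi, ∀ b c : ℝ, HasCoords (f (lensProj (eulerSU2 a b c))) a b (-c)) ∧
      (∀ T : ℝ, 0 < T → ∀ γ : ℝ → L41,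
        IsHorizontal (𝓡 3) distL41 T γ ↔ IsHorizontal 𝓘(ℝ, E2 × ℝ) distPTS2 T (fun t => f (γ t))) ∧
      (∀ T : ℝ, 0 < T → ∀ γ : ℝ → L41, IsHorizontal (𝓡 3) distL41 T γ →
        curveLength (𝓡 3) normL41 T γ =
          curveLength 𝓘(ℝ, E2 × ℝ) (normPTS2 1) T (fun t => f (γ t))) ∧
      (∀ T : ℝ, 0 < T → ∀ Γ : ℝ → PTS2, IsRegularLift T Γ →
        IsHorizontal 𝓘(ℝ, E2 × ℝ) distPTS2 T Γ ∧
        curveLength (𝓡 3) normL41 T (fun t => f.symm (Γ t)) =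
          curvatureCost 1 T (fun t => (Γ t).base)) := by
  refine ⟨lensDiffeo, fun a _ b c => ?_, fun T hT γ => isHorizontal_lensDiffeo_iff hT,
    fun T hT γ _ => curveLength_lensDiffeo hT γ, fun T hT Γ hΓ => ⟨hΓ.isHorizontal hT, ?_⟩⟩
  · have h : lensDiffeo (lensProj (eulerSU2 a b c)) = toPTS2 (eulerSU2 a b c) :=
      lensEquiv_lensProj _
    rw [h]
    exact hasCoords_toPTS2 a b c
  · rw [curveLength_lensDiffeo hT]
    simp only [Diffeomorph.apply_symm_apply]
    exact hΓ.curveLength_eq hT
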